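/- **Setting.** For $k,d\ge 1$ let $\mathcal X=\mathbb R^{kd}$, whose vectors are split into $k$ consecutive patches of dimension $d$. Fix a unit vector $w^\star\in\mathbb R^d$ and let $\mu_i\in\mathbb R^{kd}$ have $i$-th patch $w^\star$ and all other entries zero. The distribution $\mathrm{DSD}$ on $\mathcal X\times\mathbb R$ is: draw $i$ uniformly from $\{1,\dots,k\}$ and, independently, $y$ uniformly from $\{-1,1\}$; then draw $x\sim\mathcal N(y\mu_i,\sigma^2 I_{kd})$. The one-hidden-layer FCN with $k$ hidden nodes and parameter $v=[w_1,\dots,w_k,b]$ is $\mathcal M[v](x)=\sum_{i=1}^k\phi_b(w_i^{T}x)$, where $\phi_b(t)=\mathrm{ReLU}(t-b)-\mathrm{ReLU}(-t-b)$; its parameter set is $\mathcal W=\{[w_1,\dots,w_k,b]: w_i\in\mathbb R^{kd},\ \|w_i\|\le 1,\ b\ge 0\}\subseteq\mathbb R^{k^2d+1}$. An iterative algorithm $\theta_n$ on $n$ samples consists of a number $T$ of iterations, (measurable) update functions $F^1,\dots,F^T:\mathcal W\times(\mathcal X\times\mathbb R)^n\to\mathcal W$ and a probability distribution $W$ on $\mathcal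 W$. On data $S$ it draws $v^0\sim W$ independently of $S$, sets $v^t=F^t(v^{t-1},S)$ for $t=1,\dots,T$, and returns the network $\mathcal M[v^T]$. It is $\mathcal O(kd)$-equivariant if there is a set $\mathcal V$ of orthogonal transformations of $\mathbb R^{k^2d+1}$ mapping $\mathcal W$ into itself such that (a) for every $U\in\mathcal O(kd)$ there is $V\in\mathcal V$ with $\mathcal M[v](x)=\mathcal M[Vv](Ux)$ for all $v\in\mathcal W$, $x\in\mathcal X$, and $VF^t(v,\{(x_i,y_i)\}_i)=F^t(Vv,\{(Ux_i,y_i)\}_i)$ for all $t\in\{1,\dots,T\}$, all $v\in\mathcal W$ and all data sets $\{(x_i,y_i)\}_{i=1}^n$; (b) for every $V\in\mathcal V$, if $v\sim W$ then $Vv$ and $v$ have the same distribution. The risk of $f:\mathcal X\to\mathbb R$ is $R(f)=\mathbb E_{(x,y)\sim\mathrm{DSD}}(f(x)-y)^2$. For a family $(\theta_n)_{n\in\mathbb N}$ of such algorithms and $\delta\in[0,1]$, the sample complexity $n_\delta$ is the least $n$ with $\mathbb E[R(\theta_n)]\le\delta$, the expectation being over $n$ i.i.d. samples from $\mathrm{DSD}$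 and the initialization ($n_\delta=\infty$ if there is no such $n$). **Theorem.** There are absolute constants $c,C>0$ such that for all $A,B\in\mathbb R$ and $p\in\mathbb N$ there are $k_0,d_0$ such that the following holds for all $k\ge k_0$, $d\ge d_0$ with $k\le B\exp(d)$, all $0<\sigma\le A(\log k)^p/\sqrt k$ (that is, $\sigma=\tilde O(1/\sqrt k)$ and $k=O(\exp d)$) and all unit vectors $w^\star\in\mathbb R^d$. Let $(\theta_n)_{n\in\mathbb N}$ be any family of $\mathcal O(kd)$-equivariant iterative algorithms that train the FCN and whose final bias is almost surely at least $10^{-2}$, and let $\delta=0.25\cdot10^{-2}$. Then $$n_\delta\ \ge\ \max\bigl(c\,\sigma^2k^2d,\ 5k\bigr),$$ and if moreover $\sigma^2kd\ge C$, then $$n_\delta\ \ge\ \max\bigl(c\,\sigma^2k^2d,\ 40k\bigr).$$ -/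

import Mathlib

open MeasureTheory ProbabilityTheory
open scoped ENNReal

namespace DSDTask

noncomputable section

/-! ### Loss and risk -/

/-- The squared loss. -/
def err (ybar y : ℝ) : ℝ := (ybar - y) ^ 2

/-- The risk `R(f, P) = E_{(x,y) ∼ P} [err (f x) y]`, as an extended nonnegative number. -/
def risk {X : Type*} [MeasurableSpace X] (f : X → ℝ) (P : Measure (X × ℝ)) : ℝ≥0∞ :=
  ∫⁻ z, ENNReal.ofReal (err (f z.1) z.2) ∂P

/-! ### Iterative algorithms, equivariance and sample complexity

`ι` indexes the coordinates of the input space `ℝ^p`, `κ` those of the ambient space `ℝ^m` of the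
parameter set `W`, and a parametric model is a map `M : W → (ℝ^p → ℝ)`. -/

/-- An iterative algorithm on `n` labelled samples: `T` iterations, update functions
`F 1, …, F T` (the values of `F` at other indices are irrelevant), and the distribution of the
initial parameter. -/
structure IterativeAlgorithm {κ : Type*} (W : Set (EuclideanSpace ℝ κ)) (ι : Type*) (n : ℕ) where
  T : ℕ
  F : ℕ → W → (Fin n → EuclideanSpace ℝ ι × ℝ) → W
  measurable_F : ∀ t ∈ Finset.Icc 1 T,
    Measurable (fun q : W × (Fin n → EuclideanSpace ℝ ι × ℝ) => F t q.1 q.2)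
  init : Measure W
  isProbabilityMeasure_init : IsProbabilityMeasure init

namespace IterativeAlgorithm

variable {κ ι : Type*} {W : Set (EuclideanSpace ℝ κ)} {n : ℕ}

/-- The parameter `w^t` after `t` iterations, started at `w0`, on the data `S`. -/
def iterate (θ : IterativeAlgorithm W ι n) (w0 : W) (S : Fin n → EuclideanSpace ℝ ι × ℝ) : ℕ → W
  | 0 => w0
  | t + 1 => θ.F (t + 1) (iterate θ w0 S t) S

/-- The returned parameter `w^T`. -/
def output (θ : IterativeAlgorithm W ι n) (w0 : W) (S : Fin n → EuclideanSpace ℝ ι × ℝ) : W :=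
  θ.iterate w0 S θ.T

/-- `𝒰`-equivariance of the algorithm `θ` training the model `M`, for a set `𝒰` of orthogonal
transformations of the input space. The transformations in `𝒱` are orthogonal transformations of
the parameter space that map the parameter set `W` into itself. -/
def IsEquivariant (M : W → EuclideanSpace ℝ ι → ℝ) [Fintype κ] [Fintype ι]
    (𝒰 : Set (EuclideanSpace ℝ ι ≃ₗᵢ[ℝ] EuclideanSpace ℝ ι))
    (θ : IterativeAlgorithm W ι n) : Prop :=
  ∃ (𝒱 : Set (EuclideanSpace ℝ κ ≃ₗᵢ[ℝ] EuclideanSpace ℝ κ))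
    (h𝒱 : ∀ V ∈ 𝒱, Set.MapsTo V W W),
    (∀ U ∈ 𝒰, ∃ (V : EuclideanSpace ℝ κ ≃ₗᵢ[ℝ] EuclideanSpace ℝ κ) (hV : V ∈ 𝒱),
      (∀ (w : W) (x : EuclideanSpace ℝ ι), M w x = M ((h𝒱 V hV).restrict V W W w) (U x)) ∧
      (∀ t ∈ Finset.Icc 1 θ.T, ∀ (w : W) (S : Fin n → EuclideanSpace ℝ ι × ℝ),
        (h𝒱 V hV).restrict V W W (θ.F t w S) =
          θ.F t ((h𝒱 V hV).restrict V W W w) (fun i => (U (S i).1, (S i).2)))) ∧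
    (∀ (V : EuclideanSpace ℝ κ ≃ₗᵢ[ℝ] EuclideanSpace ℝ κ) (hV : V ∈ 𝒱),
      θ.init.map ((h𝒱 V hV).restrict V W W) = θ.init)

/-- The expected risk `E [R(θ_n, P)]` on `n` i.i.d. samples from `P`, the expectation being over
the independent initial parameter and samples. -/
def expectedRisk [Fintype ι] (M : W → EuclideanSpace ℝ ι → ℝ) (θ : IterativeAlgorithm W ι n)
    (P : Measure (EuclideanSpace ℝ ι × ℝ)) : ℝ≥0∞ :=
  ∫⁻ q, risk (M (θ.output q.1 q.2)) P ∂(θ.init.prod (Measure.pi fun _ : Fin n => P))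

end IterativeAlgorithm

/-- The `δ`-sample complexity of a family `θ_n` of algorithms: the least `n` for which the expected
risk of `θ_n` on `n` samples is at most `δ` (and `⊤` if there is none). -/
def sampleComplexity {κ ι : Type*} [Fintype ι] {W : Set (EuclideanSpace ℝ κ)}
    (M : W → EuclideanSpace ℝ ι → ℝ) (θ : ∀ n : ℕ, IterativeAlgorithm W ι n)
    (P : Measure (EuclideanSpace ℝ ι × ℝ)) (δ : ℝ) : ℕ∞ :=
  ⨅ (n : ℕ) (_ : (θ n).expectedRisk M P ≤ ENNReal.ofReal δ), (n : ℕ∞)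

/-! ### The Dynamic Signal Distribution -/

/-- Index set of the coordinates of `ℝ^{kd}`: the pair `(i, j)` is the `j`-th coordinate of the
`i`-th patch. -/
abbrev PatchIdx (k d : ℕ) : Type := Fin k × Fin d

/-- The input space `ℝ^{kd}`. -/
abbrev Input (k d : ℕ) : Type := EuclideanSpace ℝ (PatchIdx k d)

/-- The mean vector `μ_i`: the signal `wstar` in patch `i`, zero elsewhere. -/
def signalMean {k d : ℕ} (wstar : EuclideanSpace ℝ (Fin d)) (i : Fin k) : Input k d :=
  WithLp.toLp 2 fun a => if a.1 = i then wstar a.2 else 0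

/-- `SSD_i`: the label `y` is uniform on `{-1, 1}` and `x | y ∼ N(y μ_i, σ² I)`. -/
def SSD {k d : ℕ} (wstar : EuclideanSpace ℝ (Fin d)) (σ : ℝ) (i : Fin k) :
    Measure (Input k d × ℝ) :=
  (2 : ℝ≥0∞)⁻¹ • ∑ y ∈ ({-1, 1} : Finset ℝ),
    (multivariateGaussian (y • signalMean wstar i)
      (σ ^ 2 • (1 : Matrix (PatchIdx k d) (PatchIdx k d) ℝ))).map (fun x => (x, y))

/-- `DSD`: the index `i` is uniform on `[k]`, and then `(x, y) ∼ SSD_i`. -/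
def DSD (k d : ℕ) (wstar : EuclideanSpace ℝ (Fin d)) (σ : ℝ) : Measure (Input k d × ℝ) :=
  (k : ℝ≥0∞)⁻¹ • ∑ i : Fin k, SSD wstar σ i

/-! ### The fully connected network -/

/-- The soft-threshold activation `φ_b(x) = ReLU(x - b) - ReLU(-x - b)`. -/
def softThreshold (b x : ℝ) : ℝ := max (x - b) 0 - max (-x - b) 0

/-- Coordinates of the parameter `[w_1, …, w_k, b] ∈ ℝ^{k·kd + 1}` of the network. -/
abbrev FCNIdx (k d : ℕ) : Type := (Fin k × PatchIdx k d) ⊕ Unit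

/-- The weight vector `w_i` of hidden node `i`. -/
def fcnWeight {k d : ℕ} (v : EuclideanSpace ℝ (FCNIdx k d)) (i : Fin k) : Input k d :=
  WithLp.toLp 2 fun a => v (Sum.inl (i, a))

/-- The bias `b`. -/
def fcnBias {k d : ℕ} (v : EuclideanSpace ℝ (FCNIdx k d)) : ℝ := v (Sum.inr ())

/-- The parameter set of the network: `‖w_i‖ ≤ 1` for every hidden node, and `b ≥ 0`. -/
def fcnParams (k d : ℕ) : Set (EuclideanSpace ℝ (FCNIdx k d)) :=
  {v | (∀ i, ‖fcnWeight v i‖ ≤ 1) ∧ 0 ≤ fcnBias v}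

/-- The one-hidden-layer fully connected network `x ↦ ∑ i, φ_b(w_iᵀ x)`. -/
def fcn {k d : ℕ} (v : fcnParams k d) (x : Input k d) : ℝ :=
  ∑ i : Fin k, softThreshold (fcnBias v.1) (inner ℝ (fcnWeight v.1 i) x)

end

end DSDTask

/-! Fix the assignment `I` of samples to patches and a test patch `i` that received `m` samples. The
unit vectors orthogonal to every signal contain the vertices of a normalized hypercube of dimension
`D ≥ kd - k`. For each vertex `u` a reflection swaps `μ_i` with `u` and fixes the other signals, so
by equivariance the algorithm pays on patch `i` exactly what it would pay if that signal were `u`,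
whichever vertex `u` is (`patchRisk_lower_bound`). The patch risk is therefore at least the Bayes
risk under a uniform prior on the vertices.

Given the data, the signs of `u` are independent under the posterior, with means `tanh` of their log
odds. The weights depend only on the data and the initialization, so each has posterior mean square
correlation at most `1/D` with `u - η`, where `η` is the posterior mean; the `k` nodes together
contribute `k/D`. Moreover `‖η‖²` has expectation of order `ρ + ρ²` with `ρ = m/(σ²D)`
(`hypercube_lower_bound`). If all the correlations with `u` are small, a bias of `1/100` thresholds
signal and noise to zero, and the risk is close to `1` (`risk_fcn_signedGaussian_ge`).

Hence patch `i` has risk at least `9/10 - const · m/(σ²D)` (`patchRisk_ge_linear`). Summed over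
patches, where the `m` add up to `n`, this forces `n` to be of order `σ²kD`, hence of order `σ²k²d`
(`card_ge_of_linear`). Used only on the patches with no sample, it gives the coupon collector bound
`5k` (`one_sub_inv_pow_le_of_linear`). The bound `40k` is the first bound when `σ²kd` is large. -/

namespace DSDTask

/-! ### Product measures -/

section Pi

variable {ι : Type*} [Fintype ι] {X : ι → Type*} [∀ i, MeasurableSpace (X i)]

theorem lintegral_pi_prod (μ : ∀ i, Measure (X i)) [∀ i, IsProbabilityMeasure (μ i)]
    {f : ∀ i, X i → ℝ≥0∞} (hf : ∀ i, Measurable (f i)) :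
    ∫⁻ x, ∏ i, f i (x i) ∂(Measure.pi μ) = ∏ i, ∫⁻ x, f i x ∂(μ i) := by
  have h := lintegral_prod_eq_prod_lintegral_of_indepFun (μ := Measure.pi μ) Finset.univ
    (fun i (x : ∀ i, X i) => f i (x i)) (iIndepFun_pi fun i => (hf i).aemeasurable)
    (fun i => (hf i).comp (measurable_pi_apply i))
  rw [h]
  refine Finset.prod_congr rfl fun i _ => ?_
  exact (measurePreserving_eval μ i).lintegral_comp (hf i)

theorem pi_withDensity (μ : ∀ i, Measure (X i)) [∀ i, IsProbabilityMeasure (μ i)]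
    {f : ∀ i, X i → ℝ≥0∞} (hf : ∀ i, Measurable (f i))
    [∀ i, IsProbabilityMeasure ((μ i).withDensity (f i))] :
    Measure.pi (fun i => (μ i).withDensity (f i)) =
      (Measure.pi μ).withDensity (fun x => ∏ i, f i (x i)) := by
  refine Measure.pi_eq fun s hs => ?_
  rw [withDensity_apply _ (MeasurableSet.univ_pi hs), ← lintegral_indicator (MeasurableSet.univ_pi hs)]
  have : (Set.univ.pi s).indicator (fun x : ∀ i, X i => ∏ i, f i (x i)) =
      fun x => ∏ i, (s i).indicator (f i) (x i) := by
    ext x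
    by_cases hx : x ∈ Set.univ.pi s
    · rw [Set.indicator_of_mem hx]
      exact Finset.prod_congr rfl fun i _ => (Set.indicator_of_mem (hx i trivial) _).symm
    · rw [Set.indicator_of_notMem hx]
      simp only [Set.mem_pi, Set.mem_univ, true_implies, not_forall] at hx
      obtain ⟨i, hi⟩ := hx
      exact (Finset.prod_eq_zero (Finset.mem_univ i) (Set.indicator_of_notMem hi _)).symm
  rw [this, lintegral_pi_prod μ fun i => (hf i).indicator (hs i)]
  refine Finset.prod_congr rfl fun i _ => ?_
  rw [withDensity_apply _ (hs i), lintegral_indicator (hs i)]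

end Pi

/-- This allows conditioning on the patches of the samples: `I` records which component each sample
came from, and every `I` is equally likely. -/
theorem pi_uniform_mixture {Z : Type*} [MeasurableSpace Z] {k n : ℕ} (hk : k ≠ 0)
    (ν : Fin k → Measure Z) [∀ i, IsProbabilityMeasure (ν i)] :
    Measure.pi (fun _ : Fin n => (k : ℝ≥0∞)⁻¹ • ∑ i, ν i) =
      ((k : ℝ≥0∞)⁻¹) ^ n • ∑ I : Fin n → Fin k, Measure.pi fun l => ν (I l) := by
  have : IsFiniteMeasure ((k : ℝ≥0∞)⁻¹ • ∑ i, ν i) :=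
    Measure.smul_finite _ (ENNReal.inv_ne_top.2 (by exact_mod_cast hk))
  refine Measure.pi_eq fun s hs => ?_
  simp only [Measure.smul_apply, Measure.finsetSum_apply, Measure.pi_pi, smul_eq_mul]
  rw [Finset.prod_mul_distrib, Finset.prod_const, Finset.prod_univ_sum]
  simp

/-! ### Gaussian measures -/

theorem gaussianReal_eq_withDensity (m : ℝ) :
    gaussianReal m 1 =
      (gaussianReal 0 1).withDensity fun x => ENNReal.ofReal (Real.exp (m * x - m ^ 2 / 2)) := by
  rw [gaussianReal_of_var_ne_zero _ one_ne_zero, gaussianReal_of_var_ne_zero _ one_ne_zero,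
    ← withDensity_mul _ (measurable_gaussianPDF _ _) (by fun_prop)]
  congr 1
  ext x
  simp only [gaussianPDF, Pi.mul_apply, ← ENNReal.ofReal_mul (gaussianPDFReal_nonneg _ _ _)]
  congr 1
  simp only [gaussianPDFReal, mul_assoc, ← Real.exp_add]
  congr 2
  simp
  ring

section Std

variable {ι : Type*} [Fintype ι]

/-- Cameron–Martin in finite dimension: the one-dimensional likelihood ratios multiply over the
coordinates. -/
theorem stdGaussian_map_const_add (c : EuclideanSpace ℝ ι) :
    (stdGaussian (EuclideanSpace ℝ ι)).map (fun x => c + x) =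
      (stdGaussian (EuclideanSpace ℝ ι)).withDensity
        fun x => ENNReal.ofReal (Real.exp (inner ℝ x c - ‖c‖ ^ 2 / 2)) := by
  have hd : ∀ i, IsProbabilityMeasure ((gaussianReal 0 1).withDensity
      fun x => ENNReal.ofReal (Real.exp (c i * x - c i ^ 2 / 2))) := fun i => by
    rw [← gaussianReal_eq_withDensity]; infer_instance
  have h1 : Measure.pi (fun i => gaussianReal (c i) 1) =
      (Measure.pi fun _ : ι => gaussianReal 0 1).withDensity
        fun x => ∏ i, ENNReal.ofReal (Real.exp (c i * x i - c i ^ 2 / 2)) := by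
    rw [← pi_withDensity (fun _ : ι => gaussianReal 0 1)
      (f := fun i x => ENNReal.ofReal (Real.exp (c i * x - c i ^ 2 / 2))) (fun i => by fun_prop)]
    congr 1
    ext1 i
    exact gaussianReal_eq_withDensity _
  have h2 : Measure.pi (fun i => gaussianReal (c i) 1) =
      (Measure.pi fun _ : ι => gaussianReal 0 1).map (fun x i => c i + x i) := by
    have : ∀ i, SigmaFinite ((gaussianReal 0 1).map fun x => c i + x) := fun i => by
      rw [gaussianReal_map_const_add]; infer_instance
    rw [Measure.pi_map_pi (μ := fun _ : ι => gaussianReal 0 1) (f := fun i x => c i + x)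
      (fun i => by fun_prop)]
    simp [gaussianReal_map_const_add]
  rw [← map_pi_eq_stdGaussian, Measure.map_map (by fun_prop) (by fun_prop)]
  refine Measure.ext fun s hs => ?_
  rw [withDensity_apply _ hs, setLIntegral_map hs (by fun_prop) (by fun_prop)]
  have h3 := congrArg (fun ν => ν.map (WithLp.toLp 2)) (h2.symm.trans h1)
  rw [Measure.map_map (by fun_prop) (by fun_prop)] at h3
  refine (congrArg (fun ν => ν s) h3).trans ?_
  simp only []
  rw [Measure.map_apply (by fun_prop) hs, withDensity_apply _ (hs.preimage (by fun_prop))]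
  refine lintegral_congr fun x => ?_
  rw [← ENNReal.ofReal_prod_of_nonneg (fun i _ => (Real.exp_pos _).le), ← Real.exp_sum,
    Finset.sum_sub_distrib, EuclideanSpace.real_norm_sq_eq, Finset.sum_div]
  simp [PiLp.inner_apply]

theorem stdGaussian_map_inner (w : EuclideanSpace ℝ ι) :
    (stdGaussian (EuclideanSpace ℝ ι)).map (fun x => inner ℝ w x) =
      gaussianReal 0 (‖w‖ ^ 2).toNNReal := by
  have h := IsGaussian.map_eq_gaussianReal (μ := stdGaussian (EuclideanSpace ℝ ι)) (innerSL ℝ w)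
  rw [integral_strongDual_stdGaussian, variance_dual_stdGaussian, innerSL_apply_norm] at h
  exact h

open scoped MatrixOrder in
theorem multivariateGaussian_smul_one [DecidableEq ι] (m : EuclideanSpace ℝ ι) {σ : ℝ}
    (hσ : 0 ≤ σ) :
    multivariateGaussian m (σ ^ 2 • (1 : Matrix ι ι ℝ)) =
      (stdGaussian (EuclideanSpace ℝ ι)).map fun x => m + σ • x := by
  have h : CFC.sqrt (σ ^ 2 • (1 : Matrix ι ι ℝ)) = σ • 1 := by
    refine CFC.sqrt_unique (by simp [sq, smul_smul]) ?_
    exact (Matrix.PosSemidef.one.smul hσ).nonneg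
  rw [multivariateGaussian, h]
  congr 1
  ext x
  simp

end Std

/-! ### Label-signed Gaussian distributions -/

section Signed

variable {ι : Type*} [Fintype ι]

theorem lintegral_stdGaussian_shift (m : EuclideanSpace ℝ ι) {σ : ℝ} (hσ : 0 < σ)
    {f : EuclideanSpace ℝ ι → ℝ≥0∞} (hf : Measurable f) :
    ∫⁻ x, f (m + σ • x) ∂(stdGaussian (EuclideanSpace ℝ ι)) =
      ∫⁻ x, ENNReal.ofReal (Real.exp ((inner ℝ (σ • x) m - ‖m‖ ^ 2 / 2) / σ ^ 2)) * f (σ • x)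
        ∂(stdGaussian (EuclideanSpace ℝ ι)) := by
  have h : ∀ x, m + σ • x = σ • (σ⁻¹ • m + x) := fun x => by
    rw [smul_add, smul_smul, mul_inv_cancel₀ hσ.ne', one_smul]
  simp only [h]
  rw [← lintegral_map (f := fun x => f (σ • x)) (g := fun x => σ⁻¹ • m + x) (by fun_prop)
    (by fun_prop), stdGaussian_map_const_add, lintegral_withDensity_eq_lintegral_mul _ (by fun_prop)
    (by fun_prop)]
  refine lintegral_congr fun x => ?_
  simp only [Pi.mul_apply]
  congr 3
  rw [inner_smul_left, inner_smul_right, norm_smul, mul_pow]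
  simp
  field_simp

variable [DecidableEq ι]

/-- The label `y` is uniform on `{-1, 1}` and `x | y ∼ N(y m, σ² I)`. -/
noncomputable def signedGaussian (m : EuclideanSpace ℝ ι) (σ : ℝ) :
    Measure (EuclideanSpace ℝ ι × ℝ) :=
  (2 : ℝ≥0∞)⁻¹ • ∑ y ∈ ({-1, 1} : Finset ℝ),
    (multivariateGaussian (y • m) (σ ^ 2 • (1 : Matrix ι ι ℝ))).map (fun x => (x, y))

theorem SSD_eq_signedGaussian {k d : ℕ} (wstar : EuclideanSpace ℝ (Fin d)) (σ : ℝ) (i : Fin k) :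
    SSD wstar σ i = signedGaussian (signalMean wstar i) σ := rfl

instance (m : EuclideanSpace ℝ ι) (σ : ℝ) : IsProbabilityMeasure (signedGaussian m σ) := by
  have h : ∀ y : ℝ, IsProbabilityMeasure
      ((multivariateGaussian (y • m) (σ ^ 2 • (1 : Matrix ι ι ℝ))).map (fun x => (x, y))) :=
    fun y => Measure.isProbabilityMeasure_map (by fun_prop)
  refine ⟨?_⟩
  rw [signedGaussian, Measure.smul_apply, Finset.sum_pair (by norm_num), Measure.add_apply]
  simp only [measure_univ, smul_eq_mul]
  rw [one_add_one_eq_two, ENNReal.inv_mul_cancel (by simp) (by simp)]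

theorem lintegral_signedGaussian (m : EuclideanSpace ℝ ι) {σ : ℝ} (hσ : 0 ≤ σ)
    {f : EuclideanSpace ℝ ι × ℝ → ℝ≥0∞} (hf : Measurable f) :
    ∫⁻ z, f z ∂(signedGaussian m σ) =
      2⁻¹ * (∫⁻ x, f (-m + σ • x, -1) ∂(stdGaussian (EuclideanSpace ℝ ι)) +
        ∫⁻ x, f (m + σ • x, 1) ∂(stdGaussian (EuclideanSpace ℝ ι))) := by
  rw [signedGaussian, lintegral_smul_measure, Finset.sum_pair (by norm_num), lintegral_add_measure,
    lintegral_map hf (by fun_prop), lintegral_map hf (by fun_prop),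
    multivariateGaussian_smul_one _ hσ, multivariateGaussian_smul_one _ hσ,
    lintegral_map (by fun_prop) (by fun_prop), lintegral_map (by fun_prop) (by fun_prop)]
  simp

theorem signedGaussian_map_isometry (U : EuclideanSpace ℝ ι ≃ₗᵢ[ℝ] EuclideanSpace ℝ ι)
    (m : EuclideanSpace ℝ ι) {σ : ℝ} (hσ : 0 ≤ σ) :
    (signedGaussian m σ).map (fun z => (U z.1, z.2)) = signedGaussian (U m) σ := by
  refine Measure.ext_of_lintegral _ fun f hf => ?_
  have hU : Measurable U := U.continuous.measurable
  rw [lintegral_map hf (by fun_prop), lintegral_signedGaussian _ hσ (by fun_prop),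
    lintegral_signedGaussian _ hσ hf]
  simp only [map_add, map_neg, map_smul]
  have h : ∀ g : EuclideanSpace ℝ ι → ℝ≥0∞, Measurable g →
      ∫⁻ x, g (U x) ∂(stdGaussian (EuclideanSpace ℝ ι)) =
        ∫⁻ x, g x ∂(stdGaussian (EuclideanSpace ℝ ι)) := fun g hg => by
    conv_rhs => rw [← stdGaussian_map U, lintegral_map hg hU]
  rw [h (fun x => f (-U m + σ • x, -1)) (by fun_prop), h (fun x => f (U m + σ • x, 1)) (by fun_prop)]

theorem signedGaussian_eq_withDensity (m : EuclideanSpace ℝ ι) {σ : ℝ} (hσ : 0 < σ) :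
    signedGaussian m σ = (signedGaussian 0 σ).withDensity fun z =>
      ENNReal.ofReal (Real.exp ((z.2 * inner ℝ z.1 m - ‖m‖ ^ 2 / 2) / σ ^ 2)) := by
  refine Measure.ext_of_lintegral _ fun f hf => ?_
  rw [lintegral_withDensity_eq_lintegral_mul _ (by fun_prop) hf,
    lintegral_signedGaussian _ hσ.le hf, lintegral_signedGaussian _ hσ.le (by fun_prop),
    lintegral_stdGaussian_shift _ hσ (f := fun x => f (x, 1)) (by fun_prop),
    lintegral_stdGaussian_shift _ hσ (f := fun x => f (x, -1)) (by fun_prop)]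
  simp

/-- Multiplying by the label turns the mean `y m` into `m` and leaves the symmetric noise unchanged
in law, so both labels give the same Gaussian. -/
theorem signedGaussian_map_inner (m b : EuclideanSpace ℝ ι) (hb : ‖b‖ = 1) {σ : ℝ} (hσ : 0 ≤ σ) :
    (signedGaussian m σ).map (fun z => z.2 * inner ℝ b z.1) =
      gaussianReal (inner ℝ b m) (σ ^ 2).toNNReal := by
  have h : ∀ c : ℝ, c ^ 2 = σ ^ 2 → ∀ f : ℝ → ℝ≥0∞, Measurable f →
      ∫⁻ x, f (inner ℝ b m + c * inner ℝ b x) ∂(stdGaussian (EuclideanSpace ℝ ι)) =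
        ∫⁻ x, f x ∂(gaussianReal (inner ℝ b m) (σ ^ 2).toNNReal) := fun c hc f hf => by
    have h1 : gaussianReal (inner ℝ b m) (σ ^ 2).toNNReal =
        (stdGaussian (EuclideanSpace ℝ ι)).map fun x => inner ℝ b m + c * inner ℝ b x := by
      have h2 : (fun x : EuclideanSpace ℝ ι => inner ℝ b m + c * inner ℝ b x) =
        (fun x => inner ℝ b m + x) ∘ (fun x => c * x) ∘ fun x => inner ℝ b x := rfl
      rw [h2, ← Measure.map_map (by fun_prop) (by fun_prop),
        ← Measure.map_map (by fun_prop) (by fun_prop), stdGaussian_map_inner,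
        gaussianReal_map_const_mul, gaussianReal_map_const_add]
      congr 1
      · simp
      · ext
        simp [hb, hc, sq_nonneg]
    rw [h1, lintegral_map hf (by fun_prop)]
  refine Measure.ext_of_lintegral _ fun f hf => ?_
  rw [lintegral_map hf (by fun_prop), lintegral_signedGaussian _ hσ (by fun_prop)]
  simp only [inner_add_right, inner_neg_right, inner_smul_right]
  have h1 := h (-σ) (by ring) f hf
  have h2 := h σ rfl f hf
  have e1 : ∀ x : EuclideanSpace ℝ ι, (-1 : ℝ) * (-inner ℝ b m + σ * inner ℝ b x) =
    inner ℝ b m + -σ * inner ℝ b x := fun x => by ring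
  simp only [e1, one_mul, h1, h2]
  rw [← two_mul, ← mul_assoc, ENNReal.inv_mul_cancel (by simp) (by simp), one_mul]

theorem lintegral_sq_sum_signed_inner {n : ℕ} (J : Finset (Fin n))
    (ν : Fin n → Measure (EuclideanSpace ℝ ι × ℝ)) [∀ l, IsProbabilityMeasure (ν l)]
    (u b : EuclideanSpace ℝ ι) (hb : ‖b‖ = 1) {σ : ℝ} (hσ : 0 ≤ σ)
    (hν : ∀ l ∈ J, ν l = signedGaussian u σ) :
    ∫⁻ S, ENNReal.ofReal ((∑ l ∈ J, (S l).2 * inner ℝ b (S l).1) ^ 2) ∂(Measure.pi ν) =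
      ENNReal.ofReal ((J.card * inner ℝ b u) ^ 2 + J.card * σ ^ 2) := by
  classical
  -- Extension by zero off `J` makes the sum run over all coordinates of the product, so that
  -- `variance_sum_pi` applies; the second moment is then squared mean plus variance.
  set X : Fin n → EuclideanSpace ℝ ι × ℝ → ℝ := fun l z =>
    if l ∈ J then z.2 * inner ℝ b z.1 else 0 with hX
  have hXm : ∀ l, Measurable (X l) := fun l => by
    by_cases hl : l ∈ J <;> simp only [hX, hl, if_true, if_false] <;> fun_prop
  have hlaw : ∀ l ∈ J, (ν l).map (X l) = gaussianReal (inner ℝ b u) (σ ^ 2).toNNReal := by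
    intro l hl
    rw [hν l hl, ← signedGaussian_map_inner u b hb hσ]
    simp [hX, hl]
  have hmem : ∀ l, MemLp (X l) 2 (ν l) := by
    intro l
    by_cases hl : l ∈ J
    · have := memLp_id_gaussianReal' (μ := inner ℝ b u) (v := (σ ^ 2).toNNReal) 2 (by simp)
      rw [← hlaw l hl] at this
      exact (memLp_map_measure_iff (by fun_prop) (hXm l).aemeasurable).1 this
    · simp [hX, hl]
  have hmean : ∀ l, ∫ z, X l z ∂(ν l) = if l ∈ J then inner ℝ b u else 0 := by
    intro l
    by_cases hl : l ∈ J
    · rw [if_pos hl, ← integral_id_gaussianReal (μ := inner ℝ b u) (v := (σ ^ 2).toNNReal),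
        ← hlaw l hl, integral_map (hXm l).aemeasurable (by fun_prop)]
    · simp [hX, hl]
  have hvar : ∀ l, Var[X l; ν l] = if l ∈ J then σ ^ 2 else 0 := by
    intro l
    by_cases hl : l ∈ J
    · have := variance_id_gaussianReal (μ := inner ℝ b u) (v := (σ ^ 2).toNNReal)
      rw [← hlaw l hl, variance_id_map (hXm l).aemeasurable] at this
      rw [if_pos hl, this]
      simp [sq_nonneg]
    · have : X l = 0 := by ext z; simp [hX, hl]
      simp [this, hl]
  set Y : (Fin n → EuclideanSpace ℝ ι × ℝ) → ℝ := ∑ l, fun S => X l (S l) with hY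
  have hYm : ∀ l, MemLp (fun S : Fin n → EuclideanSpace ℝ ι × ℝ => X l (S l)) 2 (Measure.pi ν) :=
    fun l => (hmem l).comp_measurePreserving (measurePreserving_eval ν l)
  have hYmem : MemLp Y 2 (Measure.pi ν) := memLp_finsetSum' _ fun l _ => hYm l
  have hYS : ∀ S, ∑ l ∈ J, (S l).2 * inner ℝ b (S l).1 = Y S := fun S => by
    simp [hY, hX, Finset.sum_ite_mem]
  simp only [hYS]
  rw [← ofReal_integral_eq_lintegral_ofReal hYmem.integrable_sq (ae_of_all _ fun _ => sq_nonneg _)]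
  congr 1
  have hv := variance_eq_sub hYmem
  have hv' : Var[Y; Measure.pi ν] = J.card * σ ^ 2 := by
    rw [hY, variance_sum_pi hmem]
    simp [hvar]
  have he : ∫ S, Y S ∂(Measure.pi ν) = J.card * inner ℝ b u := by
    simp only [hY, Finset.sum_apply]
    rw [integral_finsetSum _ fun l _ => (hYm l).integrable (by norm_num)]
    have : ∀ l, ∫ S : Fin n → EuclideanSpace ℝ ι × ℝ, X l (S l) ∂(Measure.pi ν) =
        ∫ z, X l z ∂(ν l) := fun l => by
      rw [← (measurePreserving_eval ν l).map_eq, integral_map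
        (measurable_pi_apply l).aemeasurable (hXm l).aestronglyMeasurable]
    simp [this, hmean]
  rw [hv', he] at hv
  simp only [Pi.pow_apply] at hv
  linarith

end Signed

/-! ### Exponentially weighted signs -/

section Signs

variable {α : Type*} [Fintype α] [DecidableEq α]

/-- The sign `±1` encoded by a Boolean. -/
def boolSign (e : Bool) : ℝ := if e then 1 else -1

theorem boolSign_sq (e : Bool) : boolSign e ^ 2 = 1 := by
  cases e <;> simp [boolSign]

/-- Under the product weight, sign `a` has mean `tanh (t a)` and is independent of the other signs.
Flipping sign `a` pairs the terms so that each pair cancels. -/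
theorem sum_exp_sign_centered_mul_eq_zero (t : α → ℝ) (a : α)
    (g : (α → Bool) → ℝ) (hg : ∀ e b, g (Function.update e a b) = g e) :
    ∑ e : α → Bool, (∏ c, Real.exp (boolSign (e c) * t c)) *
      ((boolSign (e a) - Real.tanh (t a)) * g e) = 0 := by
  have hp : ∀ e : α → Bool, ∏ c, Real.exp (boolSign (e c) * t c) =
      Real.exp (boolSign (e a) * t a) * ∏ c ∈ Finset.univ.erase a,
        Real.exp (boolSign (e c) * t c) := fun e =>
    (Finset.mul_prod_erase _ _ (Finset.mem_univ a)).symm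
  have hc : Real.tanh (t a) * (Real.exp (t a) + Real.exp (-t a)) =
      Real.exp (t a) - Real.exp (-t a) := by
    rw [Real.tanh_eq_sinh_div_cosh, Real.sinh_eq, Real.cosh_eq]
    have : Real.exp (t a) + Real.exp (-t a) ≠ 0 := by positivity
    field_simp
  refine Finset.sum_involution (fun e _ => Function.update e a (!(e a))) ?_ ?_ (by simp) (by simp)
  · intro e _
    have hprod : ∏ c ∈ Finset.univ.erase a,
        Real.exp (boolSign (Function.update e a (!(e a)) c) * t c) =
        ∏ c ∈ Finset.univ.erase a, Real.exp (boolSign (e c) * t c) :=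
      Finset.prod_congr rfl fun c hc => by
        rw [Function.update_of_ne (Finset.ne_of_mem_erase hc)]
    rw [hp, hp, hprod, hg, Function.update_self]
    cases e a <;> simp only [boolSign, Bool.not_true, Bool.not_false, if_true,
      Bool.false_eq_true, if_false, one_mul, neg_mul] <;> linear_combination
        -(g e * ∏ c ∈ Finset.univ.erase a, Real.exp ((if e c = true then 1 else -1) * t c)) * hc
  · intro e _ _ h
    have := congrFun h a
    simp at this

/-- The variance of a sum of independent signs: cross terms vanish, and each diagonal term has
variance `1 - tanh² ≤ 1`. -/
theorem sum_exp_sign_centered_sq_le (t w : α → ℝ) :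
    ∑ e : α → Bool, (∏ c, Real.exp (boolSign (e c) * t c)) *
      (∑ a, w a * (boolSign (e a) - Real.tanh (t a))) ^ 2 ≤
    (∑ a, w a ^ 2) * ∑ e : α → Bool, ∏ c, Real.exp (boolSign (e c) * t c) := by
  set p : (α → Bool) → ℝ := fun e => ∏ c, Real.exp (boolSign (e c) * t c) with hp
  have hp0 : ∀ e, 0 ≤ p e := fun e => Finset.prod_nonneg fun _ _ => (Real.exp_pos _).le
  have hexp : ∀ e, p e * (∑ a, w a * (boolSign (e a) - Real.tanh (t a))) ^ 2 =
      ∑ a, ∑ b, w a * w b * (p e * ((boolSign (e a) - Real.tanh (t a)) *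
        (boolSign (e b) - Real.tanh (t b)))) := fun e => by
    rw [sq, Finset.sum_mul_sum, Finset.mul_sum]
    refine Finset.sum_congr rfl fun a _ => ?_
    rw [Finset.mul_sum]
    exact Finset.sum_congr rfl fun b _ => by ring
  refine (Finset.sum_congr rfl fun e _ => hexp e).trans_le ?_
  change _ ≤ _ * ∑ e, p e
  rw [Finset.sum_comm, Finset.sum_mul]
  refine Finset.sum_le_sum fun a _ => ?_
  rw [Finset.sum_comm, Finset.sum_eq_single a]
  · rw [← Finset.mul_sum]
    have h0 := sum_exp_sign_centered_mul_eq_zero t a (fun _ => 1) fun _ _ => rfl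
    have : ∑ e, p e * ((boolSign (e a) - Real.tanh (t a)) * (boolSign (e a) - Real.tanh (t a))) =
        (1 - Real.tanh (t a) ^ 2) * ∑ e, p e := by
      have : ∀ e, p e * ((boolSign (e a) - Real.tanh (t a)) *
          (boolSign (e a) - Real.tanh (t a))) = (1 - Real.tanh (t a) ^ 2) * p e -
          2 * Real.tanh (t a) * (p e * ((boolSign (e a) - Real.tanh (t a)) * 1)) := fun e => by
        linear_combination p e * boolSign_sq (e a)
      simp only [this]
      rw [Finset.sum_sub_distrib, ← Finset.mul_sum, ← Finset.mul_sum, h0]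
      ring
    rw [this, ← sq]
    refine mul_le_mul_of_nonneg_left ?_ (sq_nonneg _)
    exact mul_le_of_le_one_left (Finset.sum_nonneg fun e _ => hp0 e)
      (by nlinarith [sq_nonneg (Real.tanh (t a))])
  · intro b _ hb
    rw [← Finset.mul_sum, sum_exp_sign_centered_mul_eq_zero t a
      (fun e => boolSign (e b) - Real.tanh (t b)) fun e c => by
        rw [Function.update_of_ne hb], mul_zero]
  · simp

/-- For `t ≥ 0`, `tanh t ≤ 1 - exp (-2t) ≤ 2t`. The factor lost is absorbed by the absolute
constants. -/
theorem tanh_sq_le (t : ℝ) : Real.tanh t ^ 2 ≤ 4 * t ^ 2 := by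
  have h : ∀ t : ℝ, 0 ≤ t → 0 ≤ Real.tanh t ∧ Real.tanh t ≤ 2 * t := fun t ht => by
    have h1 : Real.exp (-t) ≤ Real.exp t := Real.exp_le_exp.2 (by linarith)
    have h2 := Real.add_one_le_exp (-(2 * t))
    have h3 : Real.exp (-(2 * t)) * Real.exp t = Real.exp (-t) := by
      rw [← Real.exp_add]; congr 1; ring
    have h4 := Real.exp_pos t
    have h5 := Real.exp_pos (-t)
    rw [Real.tanh_eq_sinh_div_cosh, Real.sinh_eq, Real.cosh_eq]
    refine ⟨div_nonneg (by linarith) (by linarith), ?_⟩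
    rw [div_le_iff₀ (by linarith)]
    nlinarith [mul_le_mul_of_nonneg_right h2 h4.le, mul_nonneg ht h5.le]
  rcases le_total 0 t with ht | ht
  · obtain ⟨h1, h2⟩ := h t ht
    nlinarith
  · obtain ⟨h1, h2⟩ := h (-t) (by linarith)
    rw [Real.tanh_neg] at h1 h2
    nlinarith

end Signs

/-! ### The network -/

theorem softThreshold_eq_zero {b t : ℝ} (h : |t| ≤ b) : softThreshold b t = 0 := by
  obtain ⟨h1, h2⟩ := abs_le.1 h
  rw [softThreshold, max_eq_right (by linarith), max_eq_right (by linarith), sub_zero]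

theorem continuous_fcnWeight {k d : ℕ} (i : Fin k) :
    Continuous fun v : EuclideanSpace ℝ (FCNIdx k d) => fcnWeight v i := by
  unfold fcnWeight
  fun_prop

theorem continuous_fcnBias {k d : ℕ} :
    Continuous fun v : EuclideanSpace ℝ (FCNIdx k d) => fcnBias v := by
  unfold fcnBias
  fun_prop

theorem measurable_fcn {k d : ℕ} :
    Measurable fun q : fcnParams k d × Input k d => fcn q.1 q.2 := by
  have h1 := fun i => continuous_fcnWeight (k := k) (d := d) i
  have h2 := continuous_fcnBias (k := k) (d := d)
  refine Continuous.measurable ?_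
  unfold fcn softThreshold
  refine continuous_finsetSum _ fun i _ => ?_
  have h3 : Continuous fun q : fcnParams k d × Input k d => fcnWeight q.1.1 i :=
    (h1 i).comp (by fun_prop)
  have h4 : Continuous fun q : fcnParams k d × Input k d => fcnBias q.1.1 :=
    h2.comp (by fun_prop)
  fun_prop

theorem measurable_risk_fcn {k d : ℕ} (P : Measure (Input k d × ℝ)) [SFinite P] :
    Measurable fun v : fcnParams k d => risk (fcn v) P := by
  unfold risk err
  refine Measurable.lintegral_prod_right' (f := fun q : fcnParams k d × (Input k d × ℝ) =>
    ENNReal.ofReal ((fcn q.1 q.2.1 - q.2.2) ^ 2)) ?_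
  have h : Measurable fun q : fcnParams k d × (Input k d × ℝ) => fcn q.1 q.2.1 :=
    measurable_fcn.comp (f := fun q : fcnParams k d × (Input k d × ℝ) => (q.1, q.2.1))
      (by fun_prop)
  fun_prop

theorem stdGaussian_inner_tail {ι : Type*} [Fintype ι] {w : EuclideanSpace ℝ ι} (hw : ‖w‖ ≤ 1)
    {a : ℝ} (ha : 0 ≤ a) :
    stdGaussian (EuclideanSpace ℝ ι) {x | a < |inner ℝ w x|} ≤
      ENNReal.ofReal (2 * Real.exp (-a ^ 2 / 2)) := by
  have key : ∀ w : EuclideanSpace ℝ ι, ‖w‖ ≤ 1 →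
      (stdGaussian (EuclideanSpace ℝ ι)).real {x | a ≤ inner ℝ w x} ≤ Real.exp (-a ^ 2 / 2) := by
    intro w hw
    have hlaw := stdGaussian_map_inner w
    have hint : Integrable (fun x => Real.exp (a * inner ℝ w x))
        (stdGaussian (EuclideanSpace ℝ ι)) := by
      have := integrable_exp_mul_gaussianReal (μ := 0) (v := (‖w‖ ^ 2).toNNReal) a
      rw [← hlaw] at this
      exact (integrable_map_measure (f := fun x : EuclideanSpace ℝ ι => inner ℝ w x)
        (g := fun x => Real.exp (a * x)) (by fun_prop) (by fun_prop)).1 this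
    refine (measure_ge_le_exp_mul_mgf a ha hint).trans ?_
    rw [mgf_gaussianReal hlaw, ← Real.exp_add]
    refine Real.exp_le_exp.2 ?_
    rw [Real.coe_toNNReal _ (sq_nonneg _)]
    nlinarith [mul_le_mul_of_nonneg_right (pow_le_one₀ (n := 2) (norm_nonneg w) hw) (sq_nonneg a)]
  have hsub : {x | a < |inner ℝ w x|} ⊆
      {x | a ≤ inner ℝ w x} ∪ {x : EuclideanSpace ℝ ι | a ≤ inner ℝ (-w) x} := by
    intro x hx
    rcases lt_abs.1 (show a < |inner ℝ w x| from hx) with h | h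
    · exact Or.inl h.le
    · exact Or.inr (by simpa using h.le)
  refine (measure_mono hsub).trans ((measure_union_le _ _).trans ?_)
  rw [two_mul, ENNReal.ofReal_add (Real.exp_pos _).le (Real.exp_pos _).le]
  refine add_le_add ?_ ?_ <;> rw [← ofReal_measureReal] <;> refine ENNReal.ofReal_le_ofReal ?_
  · exact key w hw
  · exact key (-w) (by rwa [norm_neg])

/-- If no weight vector is correlated with `u`, the network is close to zero on inputs drawn with
mean `± u`. -/
theorem risk_fcn_signedGaussian_ge {k d : ℕ} (v : fcnParams k d) (hv : 1 / 100 ≤ fcnBias v.1)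
    (u : Input k d) (hu : ∀ i, |inner ℝ (fcnWeight v.1 i) u| ≤ 1 / 200) {σ : ℝ} (hσ : 0 < σ) :
    ENNReal.ofReal (1 - 2 * k * Real.exp (-(1 / (200 * σ)) ^ 2 / 2)) ≤
      risk (fcn v) (signedGaussian u σ) := by
  set γ := stdGaussian (Input k d)
  set B : Set (Input k d) := ⋃ i : Fin k, {x | 1 / (200 * σ) < |inner ℝ (fcnWeight v.1 i) x|}
    with hB
  have hBm : MeasurableSet B := MeasurableSet.iUnion fun i =>
    measurableSet_lt measurable_const (by fun_prop)
  have hBle : γ B ≤ ENNReal.ofReal (2 * k * Real.exp (-(1 / (200 * σ)) ^ 2 / 2)) := by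
    refine (measure_iUnion_fintype_le _ _).trans ?_
    refine (Finset.sum_le_sum fun i _ => stdGaussian_inner_tail (v.2.1 i) (by positivity)).trans ?_
    rw [Finset.sum_const, Finset.card_univ, Fintype.card_fin, nsmul_eq_mul,
      ← ENNReal.ofReal_natCast, ← ENNReal.ofReal_mul (by positivity)]
    refine ENNReal.ofReal_le_ofReal (le_of_eq (by ring))
  have hBc : ENNReal.ofReal (1 - 2 * k * Real.exp (-(1 / (200 * σ)) ^ 2 / 2)) ≤ γ Bᶜ := by
    rw [prob_compl_eq_one_sub hBm, ENNReal.ofReal_sub _ (by positivity), ENNReal.ofReal_one]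
    exact tsub_le_tsub_left hBle _
  -- Off `B`, signal and noise each contribute at most `1/200` to a preactivation, which therefore
  -- stays within the dead zone of width `1/100`.
  have hzero : ∀ y : ℝ, y ^ 2 = 1 → ∀ x ∈ Bᶜ, fcn v (y • u + σ • x) = 0 := by
    intro y hy x hx
    refine Finset.sum_eq_zero fun i _ => softThreshold_eq_zero (le_trans ?_ hv)
    have hx' : |inner ℝ (fcnWeight v.1 i) x| ≤ 1 / (200 * σ) := by
      by_contra! h
      exact hx (Set.mem_iUnion.2 ⟨i, h⟩)
    have hy' : |y| = 1 := by
      rw [← Real.sqrt_sq_eq_abs, hy, Real.sqrt_one]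
    rw [inner_add_right, inner_smul_right, inner_smul_right]
    refine (abs_add_le _ _).trans ?_
    rw [abs_mul, abs_mul, hy', abs_of_pos hσ, one_mul]
    have : σ * |inner ℝ (fcnWeight v.1 i) x| ≤ σ * (1 / (200 * σ)) := by gcongr
    have h2 : σ * (1 / (200 * σ)) = 1 / 200 := by field_simp
    linarith [hu i]
  have hy : ∀ y : ℝ, y ^ 2 = 1 → γ Bᶜ ≤
      ∫⁻ x, ENNReal.ofReal (err (fcn v (y • u + σ • x)) y) ∂γ := by
    intro y hy
    rw [← lintegral_indicator_one hBm.compl]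
    refine lintegral_mono fun x => ?_
    by_cases hx : x ∈ Bᶜ
    · simp [Set.indicator_of_mem hx, err, hzero y hy x hx, hy]
    · simp [Set.indicator_of_notMem hx]
  have hm : Measurable (fun z : Input k d × ℝ => ENNReal.ofReal (err (fcn v z.1) z.2)) := by
    have h : Measurable fun z : Input k d × ℝ => fcn v z.1 :=
      measurable_fcn.comp (f := fun z : Input k d × ℝ => (v, z.1)) (by fun_prop)
    unfold err
    fun_prop
  rw [risk, lintegral_signedGaussian _ hσ.le hm]
  have h1 := hy 1 (by norm_num)
  have h2 := hy (-1) (by norm_num)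
  rw [one_smul] at h1
  rw [neg_one_smul] at h2
  refine hBc.trans ?_
  calc γ Bᶜ = 2⁻¹ * (γ Bᶜ + γ Bᶜ) := by
        rw [← two_mul, ← mul_assoc, ENNReal.inv_mul_cancel (by simp) (by simp), one_mul]
    _ ≤ _ := by gcongr

/-- An isometry preserving the parameter set fixes the bias: the bias axis is the recession cone
of the parameter set. -/
theorem fcnBias_isometry {k d : ℕ}
    (V : EuclideanSpace ℝ (FCNIdx k d) ≃ₗᵢ[ℝ] EuclideanSpace ℝ (FCNIdx k d))
    (hV : Set.MapsTo V (fcnParams k d) (fcnParams k d)) (v : EuclideanSpace ℝ (FCNIdx k d)) :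
    fcnBias (V v) = fcnBias v := by
  set e : EuclideanSpace ℝ (FCNIdx k d) := EuclideanSpace.single (Sum.inr ()) 1 with he
  have hbias : ∀ v, fcnBias v = inner ℝ e v := fun v => by
    simp [fcnBias, he, EuclideanSpace.inner_single_left]
  have hwe : ∀ t : ℝ, ∀ i, fcnWeight (t • e) i = 0 := fun t i => by
    ext a
    simp [fcnWeight, he]
  have hwsmul : ∀ (t : ℝ) v i, fcnWeight (t • v : EuclideanSpace ℝ (FCNIdx k d)) i =
      t • fcnWeight v i := fun t v i => by
    ext a
    simp [fcnWeight]
  have hmem : ∀ t : ℝ, 0 ≤ t → t • V e ∈ fcnParams k d := by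
    intro t ht
    rw [← map_smul]
    refine hV ⟨fun i => by simp [hwe], ?_⟩
    simp [fcnBias, he, ht]
  -- The whole ray through `V e` stays in the parameter set, where weights have norm at most `1`; a
  -- nonzero weight could be rescaled to norm `2`.
  have hw0 : ∀ i, fcnWeight (V e) i = 0 := by
    intro i
    by_contra h
    have hpos : 0 < ‖fcnWeight (V e) i‖ := norm_pos_iff.2 h
    have h1 := (hmem (2 / ‖fcnWeight (V e) i‖) (by positivity)).1 i
    rw [hwsmul, norm_smul, Real.norm_of_nonneg (by positivity), div_mul_cancel₀ _ hpos.ne'] at h1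
    norm_num at h1
  have hb0 : 0 ≤ fcnBias (V e) := by simpa using (hmem 1 zero_le_one).2
  have hVe : V e = fcnBias (V e) • e := by
    ext j
    rcases j with ⟨i, a⟩ | j
    · have := congrArg (fun x : Input k d => x a) (hw0 i)
      simpa [fcnWeight, he] using this
    · simp [fcnBias, he]
  have hn : ‖V e‖ = 1 := by rw [V.norm_map]; simp [he]
  have h1 : fcnBias (V e) = 1 := by
    rw [hVe, norm_smul, Real.norm_of_nonneg hb0] at hn
    simpa [he] using hn
  rw [h1, one_smul] at hVe
  rw [hbias, hbias]
  conv_lhs => rw [← hVe]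
  exact V.inner_map_map e v

/-! ### Equivariant algorithms -/

namespace IterativeAlgorithm

variable {κ ι : Type*} {W : Set (EuclideanSpace ℝ κ)} {n : ℕ}

theorem measurable_output (θ : IterativeAlgorithm W ι n) :
    Measurable fun q : W × (Fin n → EuclideanSpace ℝ ι × ℝ) => θ.output q.1 q.2 := by
  have h : ∀ t ≤ θ.T, Measurable fun q : W × (Fin n → EuclideanSpace ℝ ι × ℝ) =>
      θ.iterate q.1 q.2 t := by
    intro t
    induction t with
    | zero => exact fun _ => measurable_fst
    | succ t ih =>
      intro ht
      exact (θ.measurable_F (t + 1) (Finset.mem_Icc.2 ⟨by omega, ht⟩)).comp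
        ((ih (by omega)).prodMk measurable_snd)
  exact h θ.T le_rfl

theorem output_equivariant (θ : IterativeAlgorithm W ι n) (g : W → W)
    (U : EuclideanSpace ℝ ι → EuclideanSpace ℝ ι)
    (hF : ∀ t ∈ Finset.Icc 1 θ.T, ∀ (w : W) (S : Fin n → EuclideanSpace ℝ ι × ℝ),
      g (θ.F t w S) = θ.F t (g w) fun i => (U (S i).1, (S i).2))
    (w : W) (S : Fin n → EuclideanSpace ℝ ι × ℝ) :
    θ.output (g w) (fun i => (U (S i).1, (S i).2)) = g (θ.output w S) := by
  have h : ∀ t ≤ θ.T, θ.iterate (g w) (fun i => (U (S i).1, (S i).2)) t =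
      g (θ.iterate w S t) := by
    intro t
    induction t with
    | zero => exact fun _ => rfl
    | succ t ih =>
      intro ht
      rw [iterate, iterate, ih (by omega), hF _ (Finset.mem_Icc.2 ⟨by omega, ht⟩)]
  exact h θ.T le_rfl

/-- A change of variables moving parameter and data together: the initialization is invariant under
`g`, and the output commutes with the two actions. The sample laws may differ from one another, as
they do once the patches are fixed. -/
theorem lintegral_output_equivariant [Fintype ι] (θ : IterativeAlgorithm W ι n) (g : W → W)
    (hg : Measurable g) (U : EuclideanSpace ℝ ι → EuclideanSpace ℝ ι) (hU : Measurable U)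
    (hF : ∀ t ∈ Finset.Icc 1 θ.T, ∀ (w : W) (S : Fin n → EuclideanSpace ℝ ι × ℝ),
      g (θ.F t w S) = θ.F t (g w) fun i => (U (S i).1, (S i).2))
    (hinit : θ.init.map g = θ.init) {h h' : W → ℝ≥0∞} (hh' : Measurable h')
    (hgh : ∀ w, h' (g w) = h w) (P : Fin n → Measure (EuclideanSpace ℝ ι × ℝ))
    [∀ l, IsProbabilityMeasure (P l)] :
    ∫⁻ q, h' (θ.output q.1 q.2)
        ∂(θ.init.prod (Measure.pi fun l => (P l).map fun z => (U z.1, z.2))) =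
      ∫⁻ q, h (θ.output q.1 q.2) ∂(θ.init.prod (Measure.pi P)) := by
  have := θ.isProbabilityMeasure_init
  have hm : ∀ l, IsProbabilityMeasure ((P l).map fun z => (U z.1, z.2)) := fun l =>
    Measure.isProbabilityMeasure_map (by fun_prop)
  conv_lhs => rw [← hinit]
  rw [← Measure.pi_map_pi (μ := P) (f := fun _ z => (U z.1, z.2)) (fun l => by fun_prop),
    Measure.map_prod_map _ _ hg (by fun_prop),
    lintegral_map (f := fun q : W × (Fin n → EuclideanSpace ℝ ι × ℝ) => h' (θ.output q.1 q.2))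
      (hh'.comp θ.measurable_output) (by fun_prop)]
  refine lintegral_congr fun q => ?_
  rw [← hgh]
  exact congrArg h' (θ.output_equivariant g U hF q.1 q.2)

end IterativeAlgorithm

/-! ### A hypercube prior on the mean of a Gaussian -/

section Hypercube

variable {ι : Type*} [Fintype ι] {D n : ℕ}

/-- The vertex of the normalized hypercube spanned by `b` with signs `e`. -/
noncomputable def signPoint (b : Fin D → EuclideanSpace ℝ ι) (e : Fin D → Bool) :
    EuclideanSpace ℝ ι :=
  (√(D : ℝ))⁻¹ • ∑ a, boolSign (e a) • b a

/-- The exponent of the likelihood of the sign of the coordinate `a`, given the samples with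
indices in `J`. -/
noncomputable def signLogOdds (b : Fin D → EuclideanSpace ℝ ι) (σ : ℝ) (J : Finset (Fin n))
    (S : Fin n → EuclideanSpace ℝ ι × ℝ) (a : Fin D) : ℝ :=
  (∑ l ∈ J, (S l).2 * inner ℝ (b a) (S l).1) / (√(D : ℝ) * σ ^ 2)

/-- The posterior mean of a uniformly random vertex of the hypercube. -/
noncomputable def posteriorMean (b : Fin D → EuclideanSpace ℝ ι) (σ : ℝ) (J : Finset (Fin n))
    (S : Fin n → EuclideanSpace ℝ ι × ℝ) : EuclideanSpace ℝ ι :=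
  (√(D : ℝ))⁻¹ • ∑ a, Real.tanh (signLogOdds b σ J S a) • b a

theorem _root_.Orthonormal.norm_sq_sum_smul {b : Fin D → EuclideanSpace ℝ ι}
    (hb : Orthonormal ℝ b) (c : Fin D → ℝ) : ‖∑ a, c a • b a‖ ^ 2 = ∑ a, c a ^ 2 := by
  rw [← real_inner_self_eq_norm_sq, hb.inner_sum]
  simp [sq]

theorem norm_signPoint {b : Fin D → EuclideanSpace ℝ ι} (hb : Orthonormal ℝ b) (hD : 0 < D)
    (e : Fin D → Bool) : ‖signPoint b e‖ = 1 := by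
  have hD' : (0 : ℝ) < D := by exact_mod_cast hD
  have h : ‖signPoint b e‖ ^ 2 = 1 := by
    rw [signPoint, norm_smul, mul_pow, hb.norm_sq_sum_smul]
    simp [boolSign_sq, Real.sq_sqrt hD'.le, hD'.ne']
  exact (sq_eq_sq₀ (norm_nonneg _) zero_le_one).1 (by rw [h, one_pow])

theorem inner_signPoint_sq {b : Fin D → EuclideanSpace ℝ ι} (hb : Orthonormal ℝ b)
    (e : Fin D → Bool) (a : Fin D) : inner ℝ (b a) (signPoint b e) ^ 2 = (D : ℝ)⁻¹ := by
  rw [signPoint, inner_smul_right, hb.inner_right_fintype, mul_pow, boolSign_sq, inv_pow,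
    Real.sq_sqrt (Nat.cast_nonneg D), mul_one]

theorem norm_posteriorMean_sq_le {b : Fin D → EuclideanSpace ℝ ι} (hb : Orthonormal ℝ b)
    (σ : ℝ) (J : Finset (Fin n)) (S : Fin n → EuclideanSpace ℝ ι × ℝ) :
    ‖posteriorMean b σ J S‖ ^ 2 ≤
      4 / (D ^ 2 * σ ^ 4) * ∑ a, (∑ l ∈ J, (S l).2 * inner ℝ (b a) (S l).1) ^ 2 := by
  have hsq : √(D : ℝ) ^ 2 = D := Real.sq_sqrt (Nat.cast_nonneg D)
  rw [posteriorMean, norm_smul, mul_pow, hb.norm_sq_sum_smul, norm_inv, inv_pow,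
    Real.norm_of_nonneg (Real.sqrt_nonneg _), hsq]
  refine (mul_le_mul_of_nonneg_left (Finset.sum_le_sum fun a _ => tanh_sq_le _)
    (by positivity)).trans (le_of_eq ?_)
  rw [Finset.mul_sum, Finset.mul_sum]
  refine Finset.sum_congr rfl fun a _ => ?_
  rw [signLogOdds, div_pow, mul_pow, hsq]
  rcases eq_or_ne (D : ℝ) 0 with h | h
  · simp [h]
  · rcases eq_or_ne σ 0 with h' | h'
    · simp [h']
    · field_simp

/-- The posterior variance in any direction of a uniformly random vertex of the hypercube. -/
theorem sum_exp_inner_signPoint_sub_posteriorMean_sq_le {b : Fin D → EuclideanSpace ℝ ι}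
    (hb : Orthonormal ℝ b) {w : EuclideanSpace ℝ ι} (hw : ‖w‖ ≤ 1) (σ : ℝ) (J : Finset (Fin n))
    (S : Fin n → EuclideanSpace ℝ ι × ℝ) :
    ∑ e : Fin D → Bool, (∏ a, Real.exp (boolSign (e a) * signLogOdds b σ J S a)) *
      inner ℝ w (signPoint b e - posteriorMean b σ J S) ^ 2 ≤
    (D : ℝ)⁻¹ * ∑ e : Fin D → Bool, ∏ a, Real.exp (boolSign (e a) * signLogOdds b σ J S a) := by
  have hsq : √(D : ℝ) ^ 2 = D := Real.sq_sqrt (Nat.cast_nonneg D)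
  have hin : ∀ e : Fin D → Bool, inner ℝ w (signPoint b e - posteriorMean b σ J S) ^ 2 =
      (D : ℝ)⁻¹ * (∑ a, inner ℝ (b a) w *
        (boolSign (e a) - Real.tanh (signLogOdds b σ J S a))) ^ 2 := fun e => by
    rw [signPoint, posteriorMean, ← smul_sub, ← Finset.sum_sub_distrib, inner_smul_right, mul_pow,
      inv_pow, hsq, inner_sum]
    congr 2
    refine Finset.sum_congr rfl fun a _ => ?_
    rw [← sub_smul, inner_smul_right, real_inner_comm, mul_comm]
  have hbessel : ∑ a, inner ℝ (b a) w ^ 2 ≤ 1 := by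
    have := hb.sum_inner_products_le w (s := Finset.univ)
    simp only [Real.norm_eq_abs, sq_abs] at this
    exact this.trans (pow_le_one₀ (norm_nonneg _) hw)
  simp only [hin, mul_left_comm _ (D : ℝ)⁻¹]
  rw [← Finset.mul_sum]
  refine mul_le_mul_of_nonneg_left ?_ (by positivity)
  refine (sum_exp_sign_centered_sq_le (signLogOdds b σ J S) fun a => inner ℝ (b a) w).trans ?_
  exact mul_le_of_le_one_left (Finset.sum_nonneg fun e _ =>
    Finset.prod_nonneg fun _ _ => (Real.exp_pos _).le) hbessel

/-- The likelihood ratio between the means `±u` and `0`. -/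
noncomputable def plantedDensity (J : Finset (Fin n)) (σ : ℝ) (u : EuclideanSpace ℝ ι)
    (S : Fin n → EuclideanSpace ℝ ι × ℝ) : ℝ≥0∞ :=
  ∏ l ∈ J, ENNReal.ofReal (Real.exp (((S l).2 * inner ℝ (S l).1 u - ‖u‖ ^ 2 / 2) / σ ^ 2))

theorem measurable_plantedDensity (J : Finset (Fin n)) (σ : ℝ) (u : EuclideanSpace ℝ ι) :
    Measurable (plantedDensity J σ u) :=
  Finset.measurable_fun_prod _ fun l _ => by fun_prop

/-- All vertices have norm `1`, so the quadratic term of the log-likelihood does not depend on `e`,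
and the rest is linear in the signs. Hence the posterior is a product over coordinates. -/
theorem plantedDensity_signPoint {b : Fin D → EuclideanSpace ℝ ι} (hb : Orthonormal ℝ b)
    (hD : 0 < D) (J : Finset (Fin n)) (σ : ℝ) (e : Fin D → Bool)
    (S : Fin n → EuclideanSpace ℝ ι × ℝ) :
    plantedDensity J σ (signPoint b e) S = ENNReal.ofReal (Real.exp (-(J.card / (2 * σ ^ 2))) *
      ∏ a, Real.exp (boolSign (e a) * signLogOdds b σ J S a)) := by
  rw [plantedDensity, ← ENNReal.ofReal_prod_of_nonneg fun _ _ => (Real.exp_pos _).le,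
    ← Real.exp_sum, ← Real.exp_sum, ← Real.exp_add, norm_signPoint hb hD]
  congr 2
  rw [← Finset.sum_div, Finset.sum_sub_distrib, Finset.sum_const, sub_div, sub_eq_neg_add]
  congr 1
  · simp only [nsmul_eq_mul]
    ring
  · simp only [signLogOdds, signPoint, inner_smul_right, inner_sum, Finset.mul_sum, Finset.sum_div]
    rw [Finset.sum_comm]
    refine Finset.sum_congr rfl fun a _ => Finset.sum_congr rfl fun l _ => ?_
    rw [real_inner_comm]
    ring

variable [DecidableEq ι]

/-- The laws of the samples, when those with index in `J` have mean `±u`. -/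
noncomputable def plantedLaw (J : Finset (Fin n)) (ν : Fin n → Measure (EuclideanSpace ℝ ι × ℝ))
    (σ : ℝ) (u : EuclideanSpace ℝ ι) (l : Fin n) : Measure (EuclideanSpace ℝ ι × ℝ) :=
  if l ∈ J then signedGaussian u σ else ν l

instance (J : Finset (Fin n)) (ν : Fin n → Measure (EuclideanSpace ℝ ι × ℝ))
    [∀ l, IsProbabilityMeasure (ν l)] (σ : ℝ) (u : EuclideanSpace ℝ ι) (l : Fin n) :
    IsProbabilityMeasure (plantedLaw J ν σ u l) := by
  unfold plantedLaw
  split_ifs <;> infer_instance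

theorem pi_plantedLaw (J : Finset (Fin n)) (ν : Fin n → Measure (EuclideanSpace ℝ ι × ℝ))
    [∀ l, IsProbabilityMeasure (ν l)] {σ : ℝ} (hσ : 0 < σ) (u : EuclideanSpace ℝ ι) :
    Measure.pi (plantedLaw J ν σ u) =
      (Measure.pi (plantedLaw J ν σ 0)).withDensity (plantedDensity J σ u) := by
  set f : Fin n → EuclideanSpace ℝ ι × ℝ → ℝ≥0∞ := fun l z => if l ∈ J then
    ENNReal.ofReal (Real.exp ((z.2 * inner ℝ z.1 u - ‖u‖ ^ 2 / 2) / σ ^ 2)) else 1 with hf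
  have hfm : ∀ l, Measurable (f l) := fun l => by
    by_cases hl : l ∈ J <;> simp only [hf, hl, if_true, if_false] <;> fun_prop
  have h : ∀ l, plantedLaw J ν σ u l = (plantedLaw J ν σ 0 l).withDensity (f l) := fun l => by
    by_cases hl : l ∈ J
    · simp only [plantedLaw, hl, if_true, hf]
      exact signedGaussian_eq_withDensity u hσ
    · simp only [plantedLaw, hl, if_false, hf]
      exact withDensity_one.symm
  have hp : ∀ l, IsProbabilityMeasure ((plantedLaw J ν σ 0 l).withDensity (f l)) := fun l => by
    rw [← h l]; infer_instance
  rw [show plantedLaw J ν σ u = fun l => (plantedLaw J ν σ 0 l).withDensity (f l) from funext h,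
    pi_withDensity _ hfm]
  congr 1
  ext S
  simp [plantedDensity, hf, Finset.prod_ite_mem]

/-- Any `k` unit vectors computed from the samples are nearly uncorrelated with a random vertex of
the hypercube, unless the posterior mean is large. -/
theorem hypercube_lower_bound {Ω : Type*} [MeasurableSpace Ω] (π : Measure Ω)
    [IsProbabilityMeasure π] {k : ℕ} {b : Fin D → EuclideanSpace ℝ ι} (hb : Orthonormal ℝ b)
    (hD : 0 < D) {σ : ℝ} (hσ : 0 < σ) (J : Finset (Fin n))
    (ν : Fin n → Measure (EuclideanSpace ℝ ι × ℝ)) [∀ l, IsProbabilityMeasure (ν l)]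
    (w : Ω × (Fin n → EuclideanSpace ℝ ι × ℝ) → Fin k → EuclideanSpace ℝ ι)
    (hw : ∀ q r, ‖w q r‖ ≤ 1)
    (loss : Ω × (Fin n → EuclideanSpace ℝ ι × ℝ) → EuclideanSpace ℝ ι → ℝ≥0∞)
    (hloss : ∀ u, Measurable fun q => loss q u) (c : ℝ≥0∞) {K : ℝ} (hK : 0 ≤ K)
    (hc : ∀ q u η, ‖u‖ = 1 → c ≤ loss q u +
      (∑ r, ENNReal.ofReal (K * inner ℝ (w q r) (u - η) ^ 2) + ENNReal.ofReal (K * ‖η‖ ^ 2)))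
    (E : ℝ≥0∞) (hE : ∀ e, ∫⁻ q, loss q (signPoint b e)
      ∂(π.prod (Measure.pi (plantedLaw J ν σ (signPoint b e)))) = E) :
    c ≤ E + (ENNReal.ofReal (K * k / D) + ENNReal.ofReal (4 * K *
      ((J.card / (σ ^ 2 * D)) ^ 2 + J.card / (σ ^ 2 * D)))) := by
  -- The common reference law, where the samples in `J` carry no signal. Each vertex becomes a
  -- reweighting by `p e`, and for fixed `q` these weights are the unnormalized posterior.
  set Q := π.prod (Measure.pi (plantedLaw J ν σ 0)) with hQ
  set p : (Fin D → Bool) → Ω × (Fin n → EuclideanSpace ℝ ι × ℝ) → ℝ≥0∞ :=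
    fun e q => plantedDensity J σ (signPoint b e) q.2 with hp
  have hpm : ∀ e, Measurable (p e) := fun e =>
    (measurable_plantedDensity _ _ _).comp measurable_snd
  have hchange : ∀ e (X : Ω × (Fin n → EuclideanSpace ℝ ι × ℝ) → ℝ≥0∞), Measurable X →
      ∫⁻ q, X q ∂(π.prod (Measure.pi (plantedLaw J ν σ (signPoint b e)))) =
        ∫⁻ q, p e q * X q ∂Q := fun e X hX => by
    rw [pi_plantedLaw J ν hσ, prod_withDensity_right (measurable_plantedDensity _ _ _),
      lintegral_withDensity_eq_lintegral_mul _ (hpm e) hX]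
    rfl
  set R : Ω × (Fin n → EuclideanSpace ℝ ι × ℝ) → ℝ≥0∞ := fun q =>
    ENNReal.ofReal (4 * K / (D ^ 2 * σ ^ 4)) *
      ∑ a, ENNReal.ofReal ((∑ l ∈ J, (q.2 l).2 * inner ℝ (b a) (q.2 l).1) ^ 2) with hR
  have hRm : Measurable R := by
    refine Measurable.const_mul (Finset.measurable_fun_sum _ fun a _ => ?_) _
    refine Measurable.ennreal_ofReal (Measurable.pow_const ?_ 2)
    exact Finset.measurable_fun_sum _ fun l _ => by fun_prop
  have hηR : ∀ q, ENNReal.ofReal (K * ‖posteriorMean b σ J q.2‖ ^ 2) ≤ R q := fun q => by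
    simp only [hR]
    rw [← ENNReal.ofReal_sum_of_nonneg fun _ _ => sq_nonneg _, ← ENNReal.ofReal_mul
      (by positivity)]
    refine ENNReal.ofReal_le_ofReal ?_
    refine (mul_le_mul_of_nonneg_left (norm_posteriorMean_sq_le hb σ J q.2) hK).trans
      (le_of_eq ?_)
    ring
  -- The hypothesis `hc` is averaged over the posterior at fixed data, with `η` the posterior mean.
  -- The weights `w q r` do not depend on `e`, so each contributes a posterior variance of at most
  -- `1/D`.
  have hpoint : ∀ q, ∑ e, p e q * c ≤
      ∑ e, p e q * (loss q (signPoint b e) + (ENNReal.ofReal (K * k / D) + R q)) := by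
    intro q
    have hvar : ∑ e, p e q * ∑ r, ENNReal.ofReal
        (K * inner ℝ (w q r) (signPoint b e - posteriorMean b σ J q.2) ^ 2) ≤
        ∑ e, p e q * ENNReal.ofReal (K * k / D) := by
      simp only [hp, plantedDensity_signPoint hb hD]
      set m : ℝ := Real.exp (-(J.card / (2 * σ ^ 2)))
      set L : (Fin D → Bool) → ℝ := fun e =>
        ∏ a, Real.exp (boolSign (e a) * signLogOdds b σ J q.2 a)
      have hm : 0 ≤ m := (Real.exp_pos _).le
      have hL : ∀ e, 0 ≤ L e := fun e => Finset.prod_nonneg fun _ _ => (Real.exp_pos _).le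
      have h1 : ∀ e, ENNReal.ofReal (m * L e) * ∑ r, ENNReal.ofReal
          (K * inner ℝ (w q r) (signPoint b e - posteriorMean b σ J q.2) ^ 2) =
          ENNReal.ofReal (∑ r, m * K * (L e *
            inner ℝ (w q r) (signPoint b e - posteriorMean b σ J q.2) ^ 2)) := fun e => by
        rw [← ENNReal.ofReal_sum_of_nonneg fun _ _ => by positivity,
          ← ENNReal.ofReal_mul (mul_nonneg hm (hL e)), Finset.mul_sum]
        congr 1
        exact Finset.sum_congr rfl fun r _ => by ring
      have h2 : ∀ e, ENNReal.ofReal (m * L e) * ENNReal.ofReal (K * k / D) =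
          ENNReal.ofReal (m * L e * (K * k / D)) := fun e =>
        (ENNReal.ofReal_mul (mul_nonneg hm (hL e))).symm
      change ∑ e, ENNReal.ofReal (m * L e) * _ ≤ ∑ e, ENNReal.ofReal (m * L e) * _
      simp only [h1, h2]
      rw [← ENNReal.ofReal_sum_of_nonneg fun e _ => Finset.sum_nonneg fun r _ =>
          mul_nonneg (by positivity) (mul_nonneg (hL e) (sq_nonneg _)),
        ← ENNReal.ofReal_sum_of_nonneg fun e _ => mul_nonneg (mul_nonneg hm (hL e))
          (by positivity)]
      refine ENNReal.ofReal_le_ofReal ?_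
      rw [Finset.sum_comm]
      simp only [← Finset.mul_sum, ← Finset.sum_mul]
      refine (mul_le_mul_of_nonneg_left (Finset.sum_le_sum fun r _ =>
        sum_exp_inner_signPoint_sub_posteriorMean_sq_le hb (hw q r) σ J q.2)
        (mul_nonneg hm hK)).trans (le_of_eq ?_)
      rw [Finset.sum_const, Finset.card_univ, Fintype.card_fin, nsmul_eq_mul]
      ring
    calc ∑ e, p e q * c ≤ ∑ e, (p e q * loss q (signPoint b e) + (p e q * ∑ r, ENNReal.ofReal
          (K * inner ℝ (w q r) (signPoint b e - posteriorMean b σ J q.2) ^ 2) + p e q * R q)) := by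
          refine Finset.sum_le_sum fun e _ => ?_
          rw [← mul_add, ← mul_add]
          gcongr
          refine (hc q _ (posteriorMean b σ J q.2) (norm_signPoint hb hD e)).trans ?_
          gcongr
          exact hηR q
      _ ≤ _ := by
          simp only [mul_add, Finset.sum_add_distrib]
          gcongr
  have hRint : ∀ e, ∫⁻ q, R q ∂(π.prod (Measure.pi (plantedLaw J ν σ (signPoint b e)))) ≤
      ENNReal.ofReal (4 * K * ((J.card / (σ ^ 2 * D)) ^ 2 + J.card / (σ ^ 2 * D))) := by
    intro e
    have hD' : (0 : ℝ) < D := by exact_mod_cast hD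
    have hterm : ∀ a, ∫⁻ q : Ω × (Fin n → EuclideanSpace ℝ ι × ℝ), ENNReal.ofReal
        ((∑ l ∈ J, (q.2 l).2 * inner ℝ (b a) (q.2 l).1) ^ 2)
        ∂(π.prod (Measure.pi (plantedLaw J ν σ (signPoint b e)))) =
        ENNReal.ofReal (J.card ^ 2 * (D : ℝ)⁻¹ + J.card * σ ^ 2) := fun a => by
      have hm : Measurable fun S : Fin n → EuclideanSpace ℝ ι × ℝ => ENNReal.ofReal
          ((∑ l ∈ J, (S l).2 * inner ℝ (b a) (S l).1) ^ 2) :=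
        Measurable.ennreal_ofReal (Measurable.pow_const
          (Finset.measurable_fun_sum _ fun l _ => by fun_prop) 2)
      rw [(measurePreserving_snd (μ := π)).lintegral_comp hm,
        lintegral_sq_sum_signed_inner J _ (signPoint b e) (b a) (hb.1 a) hσ.le
          (fun l hl => by simp [plantedLaw, hl]), mul_pow, inner_signPoint_sq hb]
    rw [hR, lintegral_const_mul _ (Finset.measurable_fun_sum _ fun a _ =>
      Measurable.ennreal_ofReal (Measurable.pow_const
          (Finset.measurable_fun_sum _ fun l _ => by fun_prop) 2)),
      lintegral_finsetSum _ fun a _ => Measurable.ennreal_ofReal (Measurable.pow_const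
          (Finset.measurable_fun_sum _ fun l _ => by fun_prop) 2)]
    simp only [hterm]
    rw [Finset.sum_const, Finset.card_univ, Fintype.card_fin, nsmul_eq_mul,
      ← ENNReal.ofReal_natCast, ← ENNReal.ofReal_mul (by positivity),
      ← ENNReal.ofReal_mul (by positivity)]
    refine ENNReal.ofReal_le_ofReal (le_of_eq ?_)
    field_simp
  -- The average over the prior is left as a sum over all `2 ^ D` vertices; this finite nonzero
  -- factor cancels at the end.
  have hsum : ∑ _e : Fin D → Bool, c ≤ ∑ _e : Fin D → Bool, (E +
      (ENNReal.ofReal (K * k / D) + ENNReal.ofReal (4 * K *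
        ((J.card / (σ ^ 2 * D)) ^ 2 + J.card / (σ ^ 2 * D))))) := by
    calc ∑ _e : Fin D → Bool, c = ∑ e, ∫⁻ q, p e q * c ∂Q := by
          refine Finset.sum_congr rfl fun e _ => ?_
          rw [← hchange e _ measurable_const, lintegral_const, measure_univ, mul_one]
      _ = ∫⁻ q, ∑ e, p e q * c ∂Q :=
          (lintegral_finsetSum _ fun e _ => (hpm e).mul_const c).symm
      _ ≤ ∫⁻ q, ∑ e, p e q * (loss q (signPoint b e) +
            (ENNReal.ofReal (K * k / D) + R q)) ∂Q := lintegral_mono hpoint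
      _ = ∑ e, ∫⁻ q, p e q * (loss q (signPoint b e) +
            (ENNReal.ofReal (K * k / D) + R q)) ∂Q :=
          lintegral_finsetSum _ fun e _ => (hpm e).mul ((hloss _).add (hRm.const_add _))
      _ ≤ _ := by
          refine Finset.sum_le_sum fun e _ => ?_
          rw [← hchange e (fun q => loss q (signPoint b e) + (ENNReal.ofReal (K * k / D) + R q))
            ((hloss _).add (hRm.const_add _)), lintegral_add_left (hloss _),
            lintegral_add_left measurable_const, hE e, lintegral_const, measure_univ, mul_one]
          gcongr
          exact hRint e
  rw [Finset.sum_const, Finset.sum_const, nsmul_eq_mul, nsmul_eq_mul] at hsum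
  exact (ENNReal.mul_le_mul_iff_right (by simp) (by simp)).1 hsum

end Hypercube

/-! ### The signals -/

section Signal

variable {k d : ℕ} {wstar : EuclideanSpace ℝ (Fin d)}

theorem inner_signalMean (i j : Fin k) :
    inner ℝ (signalMean wstar i) (signalMean wstar j) = if i = j then ‖wstar‖ ^ 2 else 0 := by
  simp only [signalMean, PiLp.inner_apply, Fintype.sum_prod_type, EuclideanSpace.real_norm_sq_eq]
  split_ifs with h
  · subst h
    rw [Finset.sum_eq_single i]
    · simp [sq]
    · intro j _ hj
      simp [hj]
    · simp
  · refine Finset.sum_eq_zero fun a _ => Finset.sum_eq_zero fun c _ => ?_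
    by_cases ha : a = i
    · simp [ha, h]
    · simp [ha]

theorem norm_signalMean (hw : ‖wstar‖ = 1) (i : Fin k) : ‖signalMean wstar i‖ = 1 := by
  have h := inner_signalMean (wstar := wstar) i i
  rw [if_pos rfl, hw, real_inner_self_eq_norm_sq] at h
  exact (sq_eq_sq₀ (norm_nonneg _) zero_le_one).1 h

/-- The `k` signals span at most `k` dimensions, so their orthogonal complement has dimension at
least `kd - k`. -/
theorem exists_orthonormal_orthogonal_signalMean (wstar : EuclideanSpace ℝ (Fin d)) :
    ∃ (D : ℕ) (b : Fin D → Input k d), k * d ≤ D + k ∧ Orthonormal ℝ b ∧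
      ∀ a j, inner ℝ (b a) (signalMean wstar j) = 0 := by
  set N : Submodule ℝ (Input k d) := Submodule.span ℝ (Set.range (signalMean wstar)) with hN
  refine ⟨Module.finrank ℝ Nᗮ, fun a => (stdOrthonormalBasis ℝ Nᗮ a : Input k d), ?_, ?_, ?_⟩
  · have h1 := N.finrank_add_finrank_orthogonal
    have h2 : Module.finrank ℝ N ≤ k := by
      have h := finrank_range_le_card (R := ℝ) (signalMean (k := k) wstar)
      rwa [Fintype.card_fin] at h
    rw [finrank_euclideanSpace, Fintype.card_prod, Fintype.card_fin, Fintype.card_fin] at h1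
    omega
  · exact (stdOrthonormalBasis ℝ Nᗮ).orthonormal.comp_linearIsometry Nᗮ.subtypeₗᵢ
  · intro a j
    exact Submodule.inner_left_of_mem_orthogonal (Submodule.subset_span (Set.mem_range_self j))
      (stdOrthonormalBasis ℝ Nᗮ a).2

/-- The reflection in the hyperplane orthogonal to `μ_i - u` swaps these two unit vectors; the other
signals lie in that hyperplane. -/
theorem exists_isometry_signalMean (hw : ‖wstar‖ = 1) (i : Fin k) {u : Input k d} (hu : ‖u‖ = 1)
    (huμ : ∀ j, inner ℝ u (signalMean wstar j) = 0) :
    ∃ U : Input k d ≃ₗᵢ[ℝ] Input k d, U (signalMean wstar i) = u ∧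
      ∀ j, j ≠ i → U (signalMean wstar j) = signalMean wstar j := by
  refine ⟨(ℝ ∙ (signalMean wstar i - u))ᗮ.reflection,
    Submodule.reflection_sub (by rw [norm_signalMean hw, hu]), fun j hj => ?_⟩
  refine Submodule.reflection_mem_subspace_eq_self ?_
  rw [Submodule.mem_orthogonal_singleton_iff_inner_right, inner_sub_left, inner_signalMean, huμ,
    if_neg hj.symm, sub_zero]

end Signal

instance {k d : ℕ} (wstar : EuclideanSpace ℝ (Fin d)) (σ : ℝ) (i : Fin k) :
    IsProbabilityMeasure (SSD wstar σ i) := by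
  rw [SSD_eq_signedGaussian]; infer_instance

/-! ### Risk on a patch, given the patches of the samples -/

section Conditional

variable {k d n : ℕ}

/-- The expected risk on patch `i`, given the patches `I` of the samples. -/
noncomputable def patchRisk (θ : IterativeAlgorithm (fcnParams k d) (PatchIdx k d) n)
    (wstar : EuclideanSpace ℝ (Fin d)) (σ : ℝ) (I : Fin n → Fin k) (i : Fin k) : ℝ≥0∞ :=
  ∫⁻ q, risk (fcn (θ.output q.1 q.2)) (SSD wstar σ i)
    ∂(θ.init.prod (Measure.pi fun l => SSD wstar σ (I l)))

theorem expectedRisk_eq_sum_patchRisk (hk : k ≠ 0)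
    (θ : IterativeAlgorithm (fcnParams k d) (PatchIdx k d) n)
    (wstar : EuclideanSpace ℝ (Fin d)) (σ : ℝ) :
    θ.expectedRisk fcn (DSD k d wstar σ) =
      (k : ℝ≥0∞)⁻¹ ^ n * ((k : ℝ≥0∞)⁻¹ * ∑ I : Fin n → Fin k, ∑ i, patchRisk θ wstar σ I i) := by
  have := θ.isProbabilityMeasure_init
  have hm : ∀ i, Measurable fun q : fcnParams k d × (Fin n → Input k d × ℝ) =>
      risk (fcn (θ.output q.1 q.2)) (SSD wstar σ i) := fun i =>
    (measurable_risk_fcn _).comp θ.measurable_output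
  have hr : ∀ f : Input k d → ℝ, risk f (DSD k d wstar σ) =
      (k : ℝ≥0∞)⁻¹ * ∑ i, risk f (SSD wstar σ i) := fun f => by
    rw [risk, DSD, lintegral_smul_measure, lintegral_finsetSum_measure]
    rfl
  have hpi : (Measure.pi fun _ : Fin n => DSD k d wstar σ) = (k : ℝ≥0∞)⁻¹ ^ n •
      ∑ I : Fin n → Fin k, Measure.pi fun l => SSD wstar σ (I l) :=
    pi_uniform_mixture hk (SSD wstar σ)
  have hprod : ∀ (P : Measure (Fin n → Input k d × ℝ)) [SFinite P]
      (h : fcnParams k d × (Fin n → Input k d × ℝ) → ℝ≥0∞), Measurable h →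
      ∫⁻ q, h q ∂(θ.init.prod P) = ∫⁻ S, ∫⁻ v, h (v, S) ∂θ.init ∂P := fun P _ h hh =>
    lintegral_prod_symm' h hh
  have hfin : IsFiniteMeasure ((k : ℝ≥0∞)⁻¹ ^ n •
      ∑ I : Fin n → Fin k, Measure.pi fun l => SSD wstar σ (I l)) :=
    Measure.smul_finite _ (ENNReal.pow_ne_top (ENNReal.inv_ne_top.2 (by exact_mod_cast hk)))
  rw [IterativeAlgorithm.expectedRisk, hpi]
  simp only [hr]
  rw [lintegral_const_mul _ (Finset.measurable_fun_sum _ fun i _ => hm i),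
    lintegral_finsetSum _ fun i _ => hm i, mul_left_comm]
  congr 1
  simp only [patchRisk]
  rw [Finset.sum_comm, Finset.mul_sum]
  refine Finset.sum_congr rfl fun i _ => ?_
  rw [hprod _ _ (hm i), lintegral_smul_measure, lintegral_finsetSum_measure, smul_eq_mul]
  congr 1
  refine Finset.sum_congr rfl fun I _ => ?_
  rw [hprod _ _ (hm i)]

/-- Each assignment of patches has positive probability, so an almost sure property survives
conditioning on it. -/
theorem ae_patch_of_ae {wstar : EuclideanSpace ℝ (Fin d)} {σ : ℝ}
    (θ : IterativeAlgorithm (fcnParams k d) (PatchIdx k d) n)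
    {p : fcnParams k d × (Fin n → Input k d × ℝ) → Prop} (hk : k ≠ 0)
    (h : ∀ᵐ q ∂(θ.init.prod (Measure.pi fun _ : Fin n => DSD k d wstar σ)), p q)
    (I : Fin n → Fin k) :
    ∀ᵐ q ∂(θ.init.prod (Measure.pi fun l => SSD wstar σ (I l))), p q := by
  have := θ.isProbabilityMeasure_init
  have hpi : (Measure.pi fun _ : Fin n => DSD k d wstar σ) = (k : ℝ≥0∞)⁻¹ ^ n •
      ∑ I : Fin n → Fin k, Measure.pi fun l => SSD wstar σ (I l) :=
    pi_uniform_mixture hk (SSD wstar σ)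
  have hfin : IsFiniteMeasure ((k : ℝ≥0∞)⁻¹ ^ n •
      ∑ I : Fin n → Fin k, Measure.pi fun l => SSD wstar σ (I l)) :=
    Measure.smul_finite _ (ENNReal.pow_ne_top (ENNReal.inv_ne_top.2 (by exact_mod_cast hk)))
  rw [hpi] at h
  refine (Measure.AbsolutelyContinuous.rfl.prod ?_).ae_le h
  refine Measure.AbsolutelyContinuous.trans (Measure.absolutelyContinuous_of_le ?_)
    (Measure.absolutelyContinuous_smul (pow_ne_zero n (ENNReal.inv_ne_zero.2 (by simp))))
  exact Finset.single_le_sum (f := fun I : Fin n → Fin k => Measure.pi fun l => SSD wstar σ (I l))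
    (fun _ _ => Measure.zero_le _) (Finset.mem_univ I)

/-- The loss of the network `v` on the mean `u`, with a penalty if its bias is small. -/
noncomputable def penalizedLoss (σ : ℝ) (v : fcnParams k d) (u : Input k d) : ℝ≥0∞ :=
  risk (fcn v) (signedGaussian u σ) +
    {v : fcnParams k d | fcnBias v.1 < 1 / 100}.indicator 1 v

theorem measurableSet_fcnBias_lt :
    MeasurableSet {v : fcnParams k d | fcnBias v.1 < 1 / 100} :=
  measurableSet_lt ((continuous_fcnBias.comp continuous_subtype_val).measurable) measurable_const

theorem measurable_penalizedLoss (σ : ℝ) (u : Input k d) :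
    Measurable fun v : fcnParams k d => penalizedLoss σ v u :=
  (measurable_risk_fcn _).add (measurable_const.indicator measurableSet_fcnBias_lt)

/-- A Chebyshev bound written pointwise. With `160000 = 400²`, a term on the right reaches `1` once
`‖η‖` or some correlation with `u - η` exceeds `1/400`, and the penalty is `1` if the bias is small.
Otherwise every correlation with `u` is at most `1/400 + 1/400 = 1/200`. -/
theorem penalizedLoss_lower_bound {σ : ℝ} (hσ : 0 < σ) (v : fcnParams k d) (u η : Input k d) :
    ENNReal.ofReal (1 - 2 * k * Real.exp (-(1 / (200 * σ)) ^ 2 / 2)) ≤ penalizedLoss σ v u +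
      (∑ r, ENNReal.ofReal (160000 * inner ℝ (fcnWeight v.1 r) (u - η) ^ 2) +
        ENNReal.ofReal (160000 * ‖η‖ ^ 2)) := by
  set c := ENNReal.ofReal (1 - 2 * k * Real.exp (-(1 / (200 * σ)) ^ 2 / 2)) with hc
  have hc1 : c ≤ 1 := by
    rw [hc, ← ENNReal.ofReal_one]
    exact ENNReal.ofReal_le_ofReal (sub_le_self _ (by positivity))
  have hsq : ∀ x : ℝ, 1 / 400 < |x| → 1 ≤ ENNReal.ofReal (160000 * x ^ 2) := fun x hx => by
    rw [ENNReal.one_le_ofReal]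
    nlinarith [sq_abs x, abs_nonneg x]
  by_cases hb : fcnBias v.1 < 1 / 100
  · refine hc1.trans (le_add_right ?_)
    rw [penalizedLoss, Set.indicator_of_mem (show v ∈ {v : fcnParams k d | fcnBias v.1 < 1 / 100} from hb)]
    exact le_add_left le_rfl
  by_cases hη : 1 / 400 < |‖η‖|
  · exact hc1.trans (le_add_left (le_add_left (hsq _ hη)))
  by_cases hr : ∃ r, 1 / 400 < |inner ℝ (fcnWeight v.1 r) (u - η)|
  · obtain ⟨r, hr⟩ := hr
    exact hc1.trans (le_add_left (le_add_right ((hsq _ hr).trans (Finset.single_le_sum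
      (f := fun r => ENNReal.ofReal (160000 * inner ℝ (fcnWeight v.1 r) (u - η) ^ 2))
      (fun _ _ => zero_le) (Finset.mem_univ r)))))
  · push Not at hb hη hr
    refine le_add_right (le_add_right (risk_fcn_signedGaussian_ge v hb u (fun r => ?_) hσ))
    rw [abs_norm] at hη
    have h1 : |inner ℝ (fcnWeight v.1 r) η| ≤ 1 / 400 :=
      (abs_real_inner_le_norm _ _).trans (by nlinarith [v.2.1 r, norm_nonneg η])
    have h2 : inner ℝ (fcnWeight v.1 r) u =
        inner ℝ (fcnWeight v.1 r) (u - η) + inner ℝ (fcnWeight v.1 r) η := by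
      rw [← inner_add_right, sub_add_cancel]
    rw [h2]
    exact (abs_add_le _ _).trans (by linarith [hr r])

/-- Equivariance makes the expected penalized loss with any vertex planted equal to `patchRisk`, so
`hypercube_lower_bound` applies with `E` this common value. The penalty is needed because the bias
bound holds only almost surely. -/
theorem patchRisk_lower_bound (hk : k ≠ 0) {wstar : EuclideanSpace ℝ (Fin d)} (hw : ‖wstar‖ = 1)
    {σ : ℝ} (hσ : 0 < σ) (θ : IterativeAlgorithm (fcnParams k d) (PatchIdx k d) n)
    (hθ : θ.IsEquivariant fcn Set.univ)
    (hbias : ∀ᵐ q ∂(θ.init.prod (Measure.pi fun _ : Fin n => DSD k d wstar σ)),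
      (1 / 100 : ℝ) ≤ fcnBias (θ.output q.1 q.2).1)
    {D : ℕ} (hD : 0 < D) {b : Fin D → Input k d} (hb : Orthonormal ℝ b)
    (hbμ : ∀ a j, inner ℝ (b a) (signalMean wstar j) = 0) (I : Fin n → Fin k) (i : Fin k) :
    ENNReal.ofReal (1 - 2 * k * Real.exp (-(1 / (200 * σ)) ^ 2 / 2)) ≤
      patchRisk θ wstar σ I i + (ENNReal.ofReal (160000 * k / D) + ENNReal.ofReal (4 * 160000 *
        (((Finset.univ.filter fun l => I l = i).card / (σ ^ 2 * D)) ^ 2 +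
          (Finset.univ.filter fun l => I l = i).card / (σ ^ 2 * D)))) := by
  have := θ.isProbabilityMeasure_init
  refine hypercube_lower_bound θ.init hb hD hσ (Finset.univ.filter fun l => I l = i)
    (fun l => SSD wstar σ (I l)) (fun q r => fcnWeight (θ.output q.1 q.2).1 r)
    (fun q r => (θ.output q.1 q.2).2.1 r) (fun q u => penalizedLoss σ (θ.output q.1 q.2) u)
    (fun u => (measurable_penalizedLoss σ u).comp θ.measurable_output) _ (by norm_num)
    (fun q u η _ => penalizedLoss_lower_bound hσ _ u η) _ fun e => ?_
  set u := signPoint b e with hu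
  have huμ : ∀ j, inner ℝ u (signalMean wstar j) = 0 := fun j => by
    simp [hu, signPoint, inner_smul_left, sum_inner, hbμ]
  obtain ⟨U, (hUi : U _ = u), hUj⟩ := exists_isometry_signalMean hw i (norm_signPoint hb hD e) huμ
  obtain ⟨𝒱, h𝒱, hU, hinit⟩ := hθ
  obtain ⟨V, hV, hM, hF⟩ := hU U (Set.mem_univ U)
  have hUm : Measurable U := U.continuous.measurable
  have hg : Measurable ((h𝒱 V hV).restrict V (fcnParams k d) (fcnParams k d)) :=
    (V.continuous.restrict (h𝒱 V hV)).measurable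
  -- `U` moves only `μ_i`, so planting `u` in the samples of patch `i` amounts to rotating the whole
  -- data set.
  have hlaw : plantedLaw (Finset.univ.filter fun l => I l = i) (fun l => SSD wstar σ (I l)) σ u =
      fun l => (SSD wstar σ (I l)).map fun z => (U z.1, z.2) := by
    ext1 l
    rw [SSD_eq_signedGaussian, signedGaussian_map_isometry U _ hσ.le]
    by_cases hl : I l = i
    · simp [plantedLaw, hl, hUi]
    · simp [plantedLaw, hl, hUj _ hl, SSD_eq_signedGaussian]
  rw [hlaw, θ.lintegral_output_equivariant _ hg U hUm hF (hinit V hV)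
    (measurable_penalizedLoss σ u) (h := fun v => penalizedLoss σ v (signalMean wstar i)) ?_
    (fun l => SSD wstar σ (I l)), patchRisk]
  -- Under the original sample laws the bias is almost surely large enough, and the penalty
  -- disappears.
  · refine lintegral_congr_ae ?_
    filter_upwards [ae_patch_of_ae θ hk hbias I] with q hq
    rw [penalizedLoss, Set.indicator_of_notMem (by simpa using hq), add_zero]
    rfl
  · intro v
    have h1 : risk (fcn ((h𝒱 V hV).restrict V _ _ v)) (signedGaussian u σ) =
        risk (fcn v) (signedGaussian (signalMean wstar i) σ) := by
      have hm : Measurable fun z : Input k d × ℝ =>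
          ENNReal.ofReal (err (fcn ((h𝒱 V hV).restrict V _ _ v) z.1) z.2) := by
        have h : Measurable fun z : Input k d × ℝ => fcn ((h𝒱 V hV).restrict V _ _ v) z.1 :=
          measurable_fcn.comp (f := fun z : Input k d × ℝ =>
            ((h𝒱 V hV).restrict V (fcnParams k d) (fcnParams k d) v, z.1)) (by fun_prop)
        unfold err
        fun_prop
      rw [← hUi, ← signedGaussian_map_isometry U _ hσ.le, risk, lintegral_map hm (by fun_prop)]
      simp only [← hM]
      rfl
    have h2 : fcnBias ((h𝒱 V hV).restrict V (fcnParams k d) (fcnParams k d) v).1 = fcnBias v.1 :=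
      fcnBias_isometry V (h𝒱 V hV) v.1
    rw [penalizedLoss, penalizedLoss, h1]
    congr 1
    simp only [Set.indicator_apply, Set.mem_ofPred_eq, h2, Pi.one_apply]

end Conditional

/-! ### Sample complexity -/

theorem le_sampleComplexity {κ ι : Type*} [Fintype ι] {W : Set (EuclideanSpace ℝ κ)}
    {M : W → EuclideanSpace ℝ ι → ℝ} {θ : ∀ n : ℕ, IterativeAlgorithm W ι n}
    {P : Measure (EuclideanSpace ℝ ι × ℝ)} {δ x : ℝ}
    (h : ∀ n, (θ n).expectedRisk M P ≤ ENNReal.ofReal δ → x ≤ n) :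
    ENNReal.ofReal x ≤ (sampleComplexity M θ P δ : ℝ≥0∞) := by
  have h1 : ((⌈x⌉₊ : ℕ) : ℕ∞) ≤ sampleComplexity M θ P δ :=
    le_iInf₂ fun n hn => by exact_mod_cast Nat.ceil_le.2 (h n hn)
  calc ENNReal.ofReal x ≤ ENNReal.ofReal (⌈x⌉₊ : ℕ) := ENNReal.ofReal_le_ofReal (Nat.le_ceil x)
    _ = (((⌈x⌉₊ : ℕ) : ℕ∞) : ℝ≥0∞) := by simp
    _ ≤ _ := by exact_mod_cast h1

/-- The bound `exp (-z) ≤ 2 / z²` suffices: it leaves a multiple of `k σ⁴`, which is at most `A⁴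
(log k)^(4p) / k` and tends to zero. -/
theorem exists_forall_exp_tail_le (A : ℝ) (p : ℕ) : ∃ k₀ : ℕ, ∀ k : ℕ, k₀ ≤ k → ∀ σ : ℝ, 0 < σ →
    σ ≤ A * Real.log k ^ p / √(k : ℝ) →
    2 * k * Real.exp (-(1 / (200 * σ)) ^ 2 / 2) ≤ 1 / 20 := by
  set ε : ℝ := 1 / (20 * 25600000000 * (A ^ 4 + 1)) with hε
  have hA : 0 < A ^ 4 + 1 := by positivity
  have hε0 : 0 < ε := by positivity
  have h1 := (Real.isLittleO_pow_log_id_atTop (n := 4 * p)).bound hε0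
  obtain ⟨k₀, hk₀⟩ := Filter.eventually_atTop.1 (tendsto_natCast_atTop_atTop.eventually h1)
  refine ⟨max k₀ 1, fun k hk σ hσ hσk => ?_⟩
  have hk1 : (1 : ℝ) ≤ k := by exact_mod_cast (le_max_right _ _).trans hk
  have hk0 : (0 : ℝ) < k := by linarith
  have hlog : Real.log k ^ (4 * p) ≤ ε * k := by
    have := hk₀ k ((le_max_left _ _).trans hk)
    rw [Real.norm_of_nonneg (pow_nonneg (Real.log_nonneg hk1) _), id,
      Real.norm_of_nonneg hk0.le] at this
    exact this
  have hσ4 : σ ^ 4 * k ^ 2 ≤ A ^ 4 * (ε * k) := by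
    have h2 := pow_le_pow_left₀ hσ.le hσk 4
    have h3 : √(k : ℝ) ^ 4 = k ^ 2 := by
      rw [show 4 = 2 * 2 from rfl, pow_mul, Real.sq_sqrt hk0.le]
    rw [div_pow, h3, le_div_iff₀ (by positivity), mul_pow, ← pow_mul, mul_comm p 4] at h2
    exact h2.trans (mul_le_mul_of_nonneg_left hlog (by positivity))
  have hσ4' : σ ^ 4 * k ≤ A ^ 4 * ε := by
    have : (σ ^ 4 * k) * k ≤ (A ^ 4 * ε) * k := by linarith
    exact le_of_mul_le_mul_right this hk0
  have hAε : A ^ 4 * ε ≤ 1 / (20 * 25600000000) := by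
    rw [hε, mul_one_div, div_le_div_iff₀ (by positivity) (by norm_num)]
    linarith
  set z : ℝ := (1 / (200 * σ)) ^ 2 / 2 with hz
  have hz0 : 0 < z := by positivity
  have hexp : Real.exp (-z) ≤ 2 / z ^ 2 := by
    rw [Real.exp_neg, ← one_div, div_le_div_iff₀ (Real.exp_pos _) (by positivity)]
    have := Real.quadratic_le_exp_of_nonneg hz0.le
    linarith
  have hz2 : 2 / z ^ 2 = 2 * 6400000000 * σ ^ 4 := by
    rw [hz]
    field_simp
    norm_num
  rw [neg_div, ← hz]
  calc 2 * k * Real.exp (-z) ≤ 2 * k * (2 * 6400000000 * σ ^ 4) := by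
        rw [← hz2]; gcongr
    _ = 25600000000 * (σ ^ 4 * k) := by ring
    _ ≤ 25600000000 * (1 / (20 * 25600000000)) := by
        gcongr
        exact hσ4'.trans hAε
    _ = 1 / 20 := by norm_num

theorem ofReal_sum_le {α : Type*} (s : Finset α) (f : α → ℝ) :
    ENNReal.ofReal (∑ i ∈ s, f i) ≤ ∑ i ∈ s, ENNReal.ofReal (f i) := by
  classical
  induction s using Finset.induction_on with
  | empty => simp
  | insert a s ha ih =>
    rw [Finset.sum_insert ha, Finset.sum_insert ha]
    exact ENNReal.ofReal_add_le.trans (add_le_add le_rfl ih)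

/-! ### From patch risks to lower bounds on the number of samples -/

section Bounds

variable {k d n : ℕ} {wstar : EuclideanSpace ℝ (Fin d)} {σ δ : ℝ}
  {θ : IterativeAlgorithm (fcnParams k d) (PatchIdx k d) n}

theorem sum_patchRisk_le (hk : k ≠ 0)
    (h : θ.expectedRisk fcn (DSD k d wstar σ) ≤ ENNReal.ofReal δ) :
    ∑ I : Fin n → Fin k, ∑ i, patchRisk θ wstar σ I i ≤
      ENNReal.ofReal (k ^ n * (k * δ)) := by
  have hk0 : (k : ℝ≥0∞) ≠ 0 := by exact_mod_cast hk
  have hkt : (k : ℝ≥0∞) ≠ ⊤ := by simp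
  rw [expectedRisk_eq_sum_patchRisk hk] at h
  set s := ∑ I : Fin n → Fin k, ∑ i, patchRisk θ wstar σ I i
  calc s = (k : ℝ≥0∞) ^ n * (k * ((k : ℝ≥0∞)⁻¹ ^ n * ((k : ℝ≥0∞)⁻¹ * s))) := by
        rw [mul_left_comm (k : ℝ≥0∞), ← mul_assoc (k : ℝ≥0∞) _ s, ENNReal.mul_inv_cancel hk0 hkt,
          one_mul, ← mul_assoc, ← mul_pow, ENNReal.mul_inv_cancel hk0 hkt, one_pow, one_mul]
    _ ≤ (k : ℝ≥0∞) ^ n * (k * ENNReal.ofReal δ) := by gcongr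
    _ = _ := by
        rw [ENNReal.ofReal_mul (by positivity), ENNReal.ofReal_mul (by positivity),
          ENNReal.ofReal_pow (by positivity), ENNReal.ofReal_natCast]

/-- A patch with `m` samples has large risk unless `m` is at least a constant times `σ² D`. -/
theorem patchRisk_ge_linear {D : ℕ} {I : Fin n → Fin k} {i : Fin k}
    (hκ : 2 * k * Real.exp (-(1 / (200 * σ)) ^ 2 / 2) ≤ 1 / 20)
    (hD : 160000 * (k : ℝ) / D ≤ 1 / 20)
    (h : ENNReal.ofReal (1 - 2 * k * Real.exp (-(1 / (200 * σ)) ^ 2 / 2)) ≤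
      patchRisk θ wstar σ I i + (ENNReal.ofReal (160000 * k / D) + ENNReal.ofReal (4 * 160000 *
        (((Finset.univ.filter fun l => I l = i).card / (σ ^ 2 * D)) ^ 2 +
          (Finset.univ.filter fun l => I l = i).card / (σ ^ 2 * D))))) :
    ENNReal.ofReal (9 / 10 - 1280000 *
      ((Finset.univ.filter fun l => I l = i).card / (σ ^ 2 * D))) ≤ patchRisk θ wstar σ I i := by
  set ρ : ℝ := (Finset.univ.filter fun l => I l = i).card / (σ ^ 2 * D) with hρ
  have hρ0 : 0 ≤ ρ := by positivity
  -- For `ρ ≥ 1` the left side is zero. For `ρ < 1`, `ρ² ≤ ρ` gives `4 · 160000 · 2 = 1280000`, and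
  -- `9/10` is `1` minus the two errors of `1/20`.
  by_cases hρ1 : 1 ≤ ρ
  · rw [ENNReal.ofReal_of_nonpos (by linarith)]
    exact zero_le
  · push Not at hρ1
    rw [← ENNReal.ofReal_add (by positivity) (by positivity)] at h
    refine le_trans ?_ (tsub_le_iff_right.2 h)
    rw [← ENNReal.ofReal_sub _ (by positivity)]
    refine ENNReal.ofReal_le_ofReal ?_
    nlinarith

/-- The bound is linear in the number of samples of a patch, and these numbers sum to `n` for every
`I`, so no concentration argument is needed. -/
theorem card_ge_of_linear {D : ℕ} (hk : k ≠ 0) (hσ : 0 < σ) (hD : 0 < D)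
    (hδ0 : 0 ≤ δ) (h : θ.expectedRisk fcn (DSD k d wstar σ) ≤ ENNReal.ofReal δ)
    (hlin : ∀ I i, ENNReal.ofReal (9 / 10 - 1280000 *
      ((Finset.univ.filter fun l : Fin n => I l = i).card / (σ ^ 2 * D))) ≤
        patchRisk θ wstar σ I i) :
    (9 / 10 - δ) * (σ ^ 2 * k * D) ≤ 1280000 * n := by
  have hk0 : (0 : ℝ) < k := by exact_mod_cast Nat.pos_of_ne_zero hk
  have hD0 : (0 : ℝ) < D := by exact_mod_cast hD
  have hI : ∀ I : Fin n → Fin k, ENNReal.ofReal (k * (9 / 10) - 1280000 * (n / (σ ^ 2 * D))) ≤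
      ∑ i, patchRisk θ wstar σ I i := fun I => by
    have hcard : ∑ i, ((Finset.univ.filter fun l : Fin n => I l = i).card : ℝ) = n := by
      have := Finset.card_eq_sum_card_fiberwise (s := (Finset.univ : Finset (Fin n))) (f := I)
        (t := Finset.univ) (fun _ _ => Finset.mem_coe.2 (Finset.mem_univ _))
      rw [Finset.card_univ, Fintype.card_fin] at this
      exact_mod_cast this.symm
    have hsum : ∑ i, (9 / 10 - 1280000 *
        ((Finset.univ.filter fun l : Fin n => I l = i).card / (σ ^ 2 * D))) =
        k * (9 / 10) - 1280000 * (n / (σ ^ 2 * D)) := by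
      rw [Finset.sum_sub_distrib, ← Finset.mul_sum, ← Finset.sum_div _ _ (σ ^ 2 * (D : ℝ)), hcard]
      simp
    rw [← hsum]
    exact (ofReal_sum_le _ _).trans (Finset.sum_le_sum fun i _ => hlin I i)
  have htot := (Finset.sum_le_sum fun I (_ : I ∈ Finset.univ) => hI I).trans
    (sum_patchRisk_le hk h)
  rw [Finset.sum_const, Finset.card_univ, Fintype.card_fun, Fintype.card_fin, Fintype.card_fin,
    nsmul_eq_mul, ← ENNReal.ofReal_natCast, ← ENNReal.ofReal_mul (by positivity),
    ENNReal.ofReal_le_ofReal_iff (by positivity), Nat.cast_pow] at htot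
  have h2 := le_of_mul_le_mul_left htot (by positivity)
  have h3 : (9 / 10 - δ) * k ≤ 1280000 * n / (σ ^ 2 * D) := by
    rw [mul_div_assoc]; linarith
  rw [le_div_iff₀ (by positivity)] at h3
  linarith

/-- Patches without samples contribute the risk of a coupon collector. -/
theorem one_sub_inv_pow_le_of_linear {D : ℕ} (hk : k ≠ 0)
    (hδ0 : 0 ≤ δ) (h : θ.expectedRisk fcn (DSD k d wstar σ) ≤ ENNReal.ofReal δ)
    (hlin : ∀ I i, ENNReal.ofReal (9 / 10 - 1280000 *
      ((Finset.univ.filter fun l : Fin n => I l = i).card / (σ ^ 2 * D))) ≤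
        patchRisk θ wstar σ I i) :
    9 / 10 * (1 - 1 / (k : ℝ)) ^ n ≤ δ := by
  have hk0 : (0 : ℝ) < k := by exact_mod_cast Nat.pos_of_ne_zero hk
  -- The product is the indicator that patch `i` has no sample; in this form its sum over `I`
  -- factorizes into `(k - 1) ^ n`.
  have hI : ∀ (I : Fin n → Fin k) i, ENNReal.ofReal (9 / 10 * ∏ l, if I l = i then 0 else 1) ≤
      patchRisk θ wstar σ I i := fun I i => by
    by_cases hi : ∃ l, I l = i
    · obtain ⟨l, hl⟩ := hi
      have h0 : (∏ l, if I l = i then (0 : ℝ) else 1) = 0 :=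
        Finset.prod_eq_zero (Finset.mem_univ l) (if_pos hl)
      simp [h0]
    · push Not at hi
      refine le_trans (le_of_eq ?_) (hlin I i)
      simp [hi]
  have hsum : ∀ i : Fin k, ∑ I : Fin n → Fin k, (∏ l, if I l = i then (0 : ℝ) else 1) =
      (k - 1) ^ n := fun i => by
    have h1 := Finset.prod_univ_sum (fun _ : Fin n => (Finset.univ : Finset (Fin k)))
      (fun _ j => if j = i then (0 : ℝ) else 1)
    rw [Fintype.piFinset_univ] at h1
    rw [← h1]
    have h2 : ∀ j : Fin k, (if j = i then (0 : ℝ) else 1) = 1 - if j = i then 1 else 0 :=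
      fun j => by split_ifs <;> simp
    simp [h2, Finset.sum_sub_distrib]
  have htot := (Finset.sum_le_sum fun I (_ : I ∈ Finset.univ) =>
    Finset.sum_le_sum fun i (_ : i ∈ Finset.univ) => hI I i).trans (sum_patchRisk_le hk h)
  have hnn : ∀ (I : Fin n → Fin k) i, (0 : ℝ) ≤ 9 / 10 * ∏ l, if I l = i then 0 else 1 :=
    fun I i => mul_nonneg (by norm_num) (Finset.prod_nonneg fun l _ => by split_ifs <;> simp)
  simp only [← ENNReal.ofReal_sum_of_nonneg fun i _ => hnn _ i] at htot
  rw [← ENNReal.ofReal_sum_of_nonneg fun I _ => Finset.sum_nonneg fun i _ => hnn I i,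
    ENNReal.ofReal_le_ofReal_iff (by positivity), Finset.sum_comm] at htot
  simp only [← Finset.mul_sum, hsum] at htot
  rw [Finset.sum_const, Finset.card_univ, Fintype.card_fin, nsmul_eq_mul] at htot
  have h3 : (1 - 1 / (k : ℝ)) ^ n = (k - 1) ^ n / k ^ n := by
    rw [← div_pow]; congr 1; field_simp
  have h4 : (k : ℝ) * (9 / 10 * (k - 1) ^ n) ≤ k * (k ^ n * δ) := by linarith
  have h5 := le_of_mul_le_mul_left h4 hk0
  rw [h3, mul_div_assoc', div_le_iff₀ (by positivity)]
  linarith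

end Bounds

/-- For `k ≥ 11` and `n < 5k`, `n / (k - 1) ≤ 11/2`, so the power is at least `exp (-11/2) ≥ 1/300`.
Then `9/10 · 1/300 = 3/1000` exceeds `δ = 1/400`. -/
theorem five_mul_le_of_one_sub_inv_pow_le {k n : ℕ} (hk : 11 ≤ k)
    (h : 9 / 10 * (1 - 1 / (k : ℝ)) ^ n ≤ 0.25 / 100) : (5 * k : ℝ) ≤ n := by
  by_contra! hn
  have hk' : (11 : ℝ) ≤ k := by exact_mod_cast hk
  have hexp : Real.exp (-(1 / (k - 1))) ≤ 1 - 1 / (k : ℝ) := by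
    rw [Real.exp_neg, inv_le_comm₀ (Real.exp_pos _)
      (by rw [sub_pos, div_lt_one (by linarith)]; linarith)]
    refine le_trans (le_of_eq ?_) (Real.add_one_le_exp _)
    have h1 : (k : ℝ) - 1 ≠ 0 := by linarith
    have h2 : 1 - 1 / (k : ℝ) = (k - 1) / k := by field_simp
    rw [h2, inv_div]
    field_simp
    ring
  have h1 : Real.exp (-(11 / 2)) ≤ (1 - 1 / (k : ℝ)) ^ n := by
    refine le_trans ?_ (pow_le_pow_left₀ (Real.exp_pos _).le hexp n)
    rw [← Real.exp_nat_mul]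
    refine Real.exp_le_exp.2 ?_
    rw [mul_neg, neg_le_neg_iff, mul_one_div, div_le_div_iff₀ (by linarith) (by norm_num)]
    linarith
  have h2 : Real.exp (11 / 2) ≤ 300 := by
    have h3 := Real.exp_one_lt_d9
    have h4 : Real.exp (11 / 2) ^ 2 = Real.exp 1 ^ 11 := by
      rw [← Real.exp_nat_mul, ← Real.exp_nat_mul]; norm_num
    have h5 : Real.exp 1 ^ 11 ≤ 2.7182818286 ^ 11 :=
      pow_le_pow_left₀ (Real.exp_pos _).le h3.le 11
    refine le_of_sq_le_sq ?_ (by norm_num)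
    rw [h4]
    exact h5.trans (by norm_num)
  have h6 : (1 : ℝ) / 300 ≤ Real.exp (-(11 / 2)) := by
    rw [Real.exp_neg, ← one_div]
    exact one_div_le_one_div_of_le (Real.exp_pos _) h2
  rw [show (0.25 / 100 : ℝ) = 1 / 400 by norm_num] at h
  linarith

end DSDTask

/-! ### Choice of constants and conclusion -/

theorem mainTheorem1 :
    ∃ c C : ℝ, 0 < c ∧ 0 < C ∧
    -- `A`, `p` are the constants of `σ = Õ(1/√k)`, and `B` is the constant of `k = O(exp d)`
    ∀ (A B : ℝ) (p : ℕ), ∃ k₀ d₀ : ℕ, ∀ k d : ℕ, k₀ ≤ k → d₀ ≤ d →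
    (k : ℝ) ≤ B * Real.exp d →
    ∀ σ : ℝ, 0 < σ → σ ≤ A * Real.log k ^ p / √(k : ℝ) →
    ∀ wstar : EuclideanSpace ℝ (Fin d), ‖wstar‖ = 1 →
    ∀ θ : ∀ n : ℕ, DSDTask.IterativeAlgorithm (DSDTask.fcnParams k d) (DSDTask.PatchIdx k d) n,
    -- equivariance under the whole orthogonal group `O(kd)`
    (∀ n, (θ n).IsEquivariant DSDTask.fcn Set.univ) →
    -- the final bias is at least `10⁻²` almost surely
    (∀ n, ∀ᵐ q ∂((θ n).init.prod (Measure.pi fun _ : Fin n => DSDTask.DSD k d wstar σ)),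
      (1 / 100 : ℝ) ≤ DSDTask.fcnBias ((θ n).output q.1 q.2).1) →
    ENNReal.ofReal (max (c * (σ ^ 2 * k ^ 2 * d)) (5 * k)) ≤
      (DSDTask.sampleComplexity DSDTask.fcn θ (DSDTask.DSD k d wstar σ) (0.25 / 100) : ℝ≥0∞) ∧
    (C ≤ σ ^ 2 * k * d →
      ENNReal.ofReal (max (c * (σ ^ 2 * k ^ 2 * d)) (40 * k)) ≤
        (DSDTask.sampleComplexity DSDTask.fcn θ (DSDTask.DSD k d wstar σ) (0.25 / 100) : ℝ≥0∞)) := by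
  refine ⟨1 / 10000000, 400000000, by norm_num, by norm_num, fun A B p => ?_⟩
  obtain ⟨k₁, hk₁⟩ := DSDTask.exists_forall_exp_tail_le A p
  refine ⟨max k₁ 11, 10000000, fun k d hk hd _ σ hσ hσk wstar hw θ hθ hbias => ?_⟩
  have hk11 : 11 ≤ k := (le_max_right _ _).trans hk
  have hk0 : k ≠ 0 := by omega
  have hkr : (0 : ℝ) < k := by exact_mod_cast Nat.pos_of_ne_zero hk0
  have hdr : (10000000 : ℝ) ≤ d := by exact_mod_cast hd
  have hκ := hk₁ k ((le_max_left _ _).trans hk) σ hσ hσk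
  obtain ⟨D, b, hDk, hb, hbμ⟩ := DSDTask.exists_orthonormal_orthogonal_signalMean (k := k) wstar
  have hDr : (k * d : ℝ) ≤ D + k := by exact_mod_cast hDk
  have hDhalf : (k * d : ℝ) ≤ 2 * D := by nlinarith
  have hD0r : (0 : ℝ) < D := by nlinarith
  have hD0 : 0 < D := by exact_mod_cast hD0r
  -- This requires `D ≥ 3200000 k`, which `D ≥ k (d - 1)` and `d ≥ 10⁷` provide.
  have hDκ : 160000 * (k : ℝ) / D ≤ 1 / 20 := by
    rw [div_le_iff₀ hD0r]
    nlinarith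
  have hlin : ∀ n I i, _ := fun n I i => DSDTask.patchRisk_ge_linear hκ hDκ
    (DSDTask.patchRisk_lower_bound hk0 hw hσ (θ n) (hθ n) (hbias n) hD0 hb hbμ I i)
  have hfive : ∀ n, (θ n).expectedRisk DSDTask.fcn (DSDTask.DSD k d wstar σ) ≤
      ENNReal.ofReal (0.25 / 100) → (5 * k : ℝ) ≤ n := fun n hn =>
    DSDTask.five_mul_le_of_one_sub_inv_pow_le hk11
      (DSDTask.one_sub_inv_pow_le_of_linear hk0 (by norm_num) hn (hlin n))
  -- The constant has room to spare: `kd ≤ 2D` gives `σ²k²d ≤ (2 · 1280000 / 0.8975) n`, which is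
  -- below `10⁷ n`.
  have hmain : ∀ n, (θ n).expectedRisk DSDTask.fcn (DSDTask.DSD k d wstar σ) ≤
      ENNReal.ofReal (0.25 / 100) → 1 / 10000000 * (σ ^ 2 * k ^ 2 * d) ≤ n := fun n hn => by
    have h1 := DSDTask.card_ge_of_linear hk0 hσ hD0 (by norm_num) hn (hlin n)
    have h2 : σ ^ 2 * k * (k * d) ≤ σ ^ 2 * k * (2 * D) := by gcongr
    have h3 : 0 ≤ σ ^ 2 * k * D := by positivity
    norm_num at h1
    nlinarith
  refine ⟨DSDTask.le_sampleComplexity fun n hn => max_le (hmain n hn) (hfive n hn), fun hC =>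
    DSDTask.le_sampleComplexity fun n hn => max_le (hmain n hn) ?_⟩
  -- `C` is chosen so that `c * C = 40`; the bound `40k` then follows from `hmain`.
  have h1 : 400000000 * k ≤ σ ^ 2 * k * d * k := by gcongr
  linarith [hmain n hn]
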